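/- Let $\Lambda\subset\mathbb{R}^k$ be compact and let $\mu$ be a Borel probability measure on $\Lambda$. For each $\lambda\in\Lambda$ let $\mathbb{I}_\lambda=\{f_\lambda^1,\dots,f_\lambda^{N(\lambda)}\}$ be a finite family of maps $\mathbb{R}^d\to\mathbb{R}^d$ with $N(\lambda)\le\mathscr{N}$ for a fixed $\mathscr{N}\in\mathbb{N}$, depending measurably on $\lambda$. If $0\in\Lambda$, then $0$ is an isolated point of $\Lambda$; moreover $\mathbb{I}_\lambda=\varnothing$ if and only if $\lambda=0$. Assume: (a) (uniform similarities) there are $0<c_{\min}\le c_{\max}<1$ such that each $f_\lambda^i$ ($1\le i\le N(\lambda)$) is a similarity with ratio in $[c_{\min},c_{\max}]$; (b) (non-extinguishing) $\int_\Lambda N(\lambda)\,d\mu(\lambda)>1$; (c) (uniform open set condition) there is a non-empty open set $\mathcal{O}\subseteq\mathbb{R}^d$ such that, for every $\lambda\in\Lambda$, $f_\lambda^i(\mathcal{O})\subseteq\mathcal{O}$ for all $1\le i\le N(\lambda)$, and the sets $f_\lambda^1(\mathcal{O}),\dots,f_\lambda^{N(\lambda)}(\mathcal{O})$ are pairwise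 disjoint. Label the nodes of the rooted $\mathscr{N}$-ary tree independently with law $\mu$. Let $\mathcal{T}$ be the space of labellings $\tau$ and $\mathbb{P}$ the resulting product measure on $\mathcal{T}$; write $\tau(v)\in\Lambda$ for the label of the node $v=(v_1,\dots,v_n)$, $v_j\in\{1,\dots,\mathscr{N}\}$, where $n=0$ is the root. Let $\mathbf{T}_\tau^n$ be the set of nodes $v=(v_1,\dots,v_n)$ with $v_{j}\le N(\tau(v_1,\dots,v_{j-1}))$ for $1\le j\le n$, and for such $v$ put $f_{\tau,v}=f_{\tau()}^{v_1}\circ f_{\tau(v_1)}^{v_2}\circ\cdots\circ f_{\tau(v_1,\dots,v_{n-1})}^{v_n}$. Let $\Delta\subset\mathbb{R}^d$ be a non-empty compact set with $f_\lambda^i(\Delta)\subseteq\Delta$ for all $\lambda\in\Lambda$ and $1\le i\le N(\lambda)$. The random recursive set is $$F_\tau=\bigcap_{n\ge1}\ \bigcup_{v\in\mathbf{T}_\tau^n} f_{\tau,v}(\Delta).$$ For a bounded set $X\subset\mathbb{R}^d$ let $N_r(X)$ be the minimal number of sets of diameter at most $r$ needed to cover $X$, and let $|X|$ be the diameter of $X$.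 The box-counting dimension is $\dim_B X=\lim_{r\to0}\frac{\log N_r(X)}{-\log r}$ if this limit exists. For $\theta\in(0,1)$ the Assouad spectrum is $$\dim_A^\theta X=\inf\Big\{\alpha\ge0 \;:\; \exists\, C>0\ \ \forall\, 0<r^\theta=R\le|X|\ \ \max_{x\in X}N_r(B(x,R)\cap X)\le C\,(R/r)^\alpha\Big\},$$ where $B(x,R)$ is the open ball. The empty set has $\dim_B\varnothing=\dim_A^\theta\varnothing=0$. Then for $\mathbb{P}$-almost every $\tau\in\mathcal{T}$ the box-counting dimension of $F_\tau$ exists and, for every $\theta\in(0,1)$, $$\dim_A^\theta F_\tau=\dim_B F_\tau .$$ In particular, almost surely, the Assouad spectrum $\theta\mapsto\dim_A^\theta F_\tau$ is constant on $(0,1)$. -/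

import Mathlib

open Set Filter Topology MeasureTheory
open scoped NNReal ENNReal

/-! ### Covering numbers, box-counting dimension and Assouad spectrum -/

/-- `N_r(X)`: the minimal number of sets of diameter (at most) `r` needed to cover `X`
(`⊤` if no finite number of such sets suffices). -/
noncomputable def coverNum {E : Type*} [MetricSpace E] (r : ℝ) (X : Set E) : ℕ∞ :=
  ⨅ (U : Finset (Set E)) (_ : (∀ u ∈ U, Metric.ediam u ≤ ENNReal.ofReal r) ∧ X ⊆ ⋃ u ∈ U, u),
    (U.card : ℕ∞)

/-- `N_{r,R}(F)`: the maximum of `N_r(B(x,R) ∩ F)` over the centres `x ∈ F`. -/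
noncomputable def localCoverNum {E : Type*} [MetricSpace E] (r R : ℝ) (F : Set E) : ℕ∞ :=
  ⨆ x ∈ F, coverNum r (Metric.ball x R ∩ F)

/-- For a totally bounded set `F`: the box-counting dimension of `F` exists and equals `s`,
i.e. `log N_r(F) / (-log r) → s` as `r → 0`. Since `Real.log 0 = 0`, the empty set has
dimension `0`. -/
def HasBoxDim {E : Type*} [MetricSpace E] (F : Set E) (s : ℝ≥0) : Prop :=
  Tendsto (fun r : ℝ => Real.log ((coverNum r F).toNat : ℝ) / (-Real.log r)) (𝓝[>] 0) (𝓝 (s : ℝ))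

/-- The Assouad spectrum `dim_A^θ F` of a bounded set `F`: the infimum of the exponents `α ≥ 0`
for which there is `C > 0` with `N_{r,R}(F) ≤ C (R / r)^α` whenever `0 < r` and
`r ^ θ = R ≤ |F|`. (As soon as `F` has two points, no negative exponent is admissible; sets with
at most one point get the value `0`.) -/
noncomputable def assouadSpectrum {E : Type*} [MetricSpace E] (θ : ℝ) (F : Set E) : ℝ≥0∞ :=
  ⨅ (α : ℝ≥0) (_ : ∃ C : ℝ, 0 < C ∧ ∀ r R : ℝ, 0 < r → r ^ θ = R → R ≤ Metric.diam F →
      (localCoverNum r R F : ℝ≥0∞) ≤ ENNReal.ofReal (C * (R / r) ^ (α : ℝ))), (α : ℝ≥0∞)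

/-! ### Random iterated function systems -/

/-- A random iterated function system on `ℝ^d` with parameters in `ℝ^k`. -/
structure RIFS (d k : ℕ) where
  /-- the uniform bound for the number of maps -/
  maxN : ℕ
  /-- the parameter set -/
  Λ : Set (EuclideanSpace ℝ (Fin k))
  isCompact_Λ : IsCompact Λ
  /-- the law of the parameter -/
  μ : Measure Λ
  isProb : IsProbabilityMeasure μ
  /-- the number of maps of the system with parameter `l` -/
  N : Λ → ℕ
  N_le : ∀ l, N l ≤ maxN
  measurable_N : Measurable N
  /-- the system with parameter `l` consists of the maps `f l i` with `i < N l`;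
  the other `f l i` are never used -/
  f : Λ → Fin maxN → EuclideanSpace ℝ (Fin d) → EuclideanSpace ℝ (Fin d)
  measurable_f : ∀ (i : Fin maxN) (x : EuclideanSpace ℝ (Fin d)),
    Measurable fun l : {l : Λ // (i : ℕ) < N l} => f l.1 i x
  /-- the point `0` is isolated in `Λ` if it belongs to `Λ` -/
  isolated_zero : (0 : EuclideanSpace ℝ (Fin k)) ∈ Λ → ∃ ε > 0, ∀ l ∈ Λ, ‖l‖ < ε → l = 0
  /-- the empty system is attached to the parameter `0` and to no other -/
  N_eq_zero_iff : ∀ l : Λ, N l = 0 ↔ (l : EuclideanSpace ℝ (Fin k)) = 0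

namespace RIFS

variable {d k : ℕ}

/-- The space of labellings of the rooted `maxN`-ary tree by parameters. The node
`(v₁, …, v_n)` is the list `[v₁, …, v_n]`, the root is `[]`. -/
abbrev Labelling (S : RIFS d k) : Type := List (Fin S.maxN) → S.Λ

/-- The law on labellings under which all labels are independent with law `μ`. -/
noncomputable def prob (S : RIFS d k) : Measure S.Labelling :=
  Measure.infinitePi fun _ : List (Fin S.maxN) => S.μ

/-- The labelling of the full subtree that starts at the `i`-th child of the root. -/
def shift (S : RIFS d k) (τ : S.Labelling) (i : Fin S.maxN) : S.Labelling := fun v => τ (i :: v)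

/-- The coding of the node `v` is not annihilated: each step `v_{j+1}` of `v` is the index of a
map of the system whose parameter is the label `τ (v₁, …, v_j)` of the parent node. -/
def IsCoding (S : RIFS d k) : S.Labelling → List (Fin S.maxN) → Prop
  | _, [] => True
  | τ, i :: v => (i : ℕ) < S.N (τ []) ∧ S.IsCoding (S.shift τ i) v

/-- The composition `f_{e₁} ∘ ⋯ ∘ f_{e_n}` along the coding of the node `v`, where
`f_{e_{j+1}}` is the map number `v_{j+1}` of the system with parameter `τ (v₁, …, v_j)`. -/
def codingMap (S : RIFS d k) :
    S.Labelling → List (Fin S.maxN) → EuclideanSpace ℝ (Fin d) → EuclideanSpace ℝ (Fin d)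
  | _, [] => id
  | τ, i :: v => S.f (τ []) i ∘ S.codingMap (S.shift τ i) v

/-- All maps of the system are similarities whose ratios are bounded away from `0` and `1`. -/
def UniformSimilarities (S : RIFS d k) : Prop :=
  ∃ cmin cmax : ℝ, 0 < cmin ∧ cmin ≤ cmax ∧ cmax < 1 ∧
    ∀ (l : S.Λ) (i : Fin S.maxN), (i : ℕ) < S.N l →
      ∃ c : ℝ, cmin ≤ c ∧ c ≤ cmax ∧ ∀ x y, dist (S.f l i x) (S.f l i y) = c * dist x y

/-- The expected number of maps is larger than one. -/
def NonExtinguishing (S : RIFS d k) : Prop :=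
  1 < ∫ l, (S.N l : ℝ) ∂S.μ

/-- The uniform open set condition. -/
def UOSC (S : RIFS d k) : Prop :=
  ∃ O : Set (EuclideanSpace ℝ (Fin d)), IsOpen O ∧ O.Nonempty ∧
    (∀ (l : S.Λ) (i : Fin S.maxN), (i : ℕ) < S.N l → S.f l i '' O ⊆ O) ∧
    (∀ (l : S.Λ) (i j : Fin S.maxN), (i : ℕ) < S.N l → (j : ℕ) < S.N l →
      (S.f l i '' O ∩ S.f l j '' O).Nonempty → i = j)

/-- `Δ` is a non-empty compact set that every map of the system sends into itself. -/
def IsSeed (S : RIFS d k) (Δ : Set (EuclideanSpace ℝ (Fin d))) : Prop :=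
  IsCompact Δ ∧ Δ.Nonempty ∧
    ∀ (l : S.Λ) (i : Fin S.maxN), (i : ℕ) < S.N l → S.f l i '' Δ ⊆ Δ

/-- The random recursive set `F_τ`, built from `Δ`: the intersection over the levels `n ≥ 1` of
the unions of the images of `Δ` under the compositions coded by the nodes of level `n`. -/
def randomSet (S : RIFS d k) (Δ : Set (EuclideanSpace ℝ (Fin d))) (τ : S.Labelling) :
    Set (EuclideanSpace ℝ (Fin d)) :=
  ⋂ (n : ℕ) (_ : 1 ≤ n), ⋃ (v : List (Fin S.maxN)) (_ : v.length = n ∧ S.IsCoding τ v),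
    S.codingMap τ v '' Δ

end RIFS

/-! ### Covering numbers -/

section Covering

variable {E : Type*} [MetricSpace E]

/-! Let `s` be the exponent at which the expected sum of the `t`-th powers of the ratios crosses
`1`: it is above `1` for `t < s` and below `1` for `t > s`. If the tree dies out, `F_τ` is empty.
Otherwise `s` is almost surely both the box dimension and every value of the Assouad spectrum.
Everything is read off from stopping lines: the nodes where the product of the ratios first drops to
`ξ` or below. Their number obeys a branching recursion in which `ξ` is divided by the ratio of the
child, and it has order `ξ ^ (-s)` up to subexponential factors.

Upper bound. For `t > s` the recursion preserves a bound on the exponential moment of `ξ ^ t` times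
the number of nodes (`lintegral_exp_cutCount_le`). The resulting exponential tails beat a union
bound over all nodes of level at most `K * n`, so by Borel-Cantelli all these subtrees together have
at most `b ^ (-n * t)` nodes in their stopping line at `b ^ n`, for large `n`
(`ae_eventually_cutCount_le`). A ball of radius `R = r ^ θ` meets boundedly many pieces of size `R`,
by the open set condition (`exists_overlap_bound`). These pieces have level at most `K * n` when `b
^ n` is comparable to `r / R = r ^ (1 - θ)`, because `r ^ θ` is at least the power `K` of `r ^ (1 -
θ)` once `K ≥ θ / (1 - θ)`; this is where `θ < 1` enters. Hence the local covering numbers are at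
most a constant times `(R / r) ^ t`. The root alone gives the upper box dimension.

Lower bound. For `t < s` the same moment recursion with negative exponents yields, with positive
probability, an infinite subtree that branches fast enough for `C * ξ ^ (-t)` surviving nodes
(`exists_prob_pos_le_cutCount`). On survival some node almost surely carries such a subtree, by
convexity of the generating function of the offspring number (`ae_exists_sub_mem`), and bounded
overlap turns nodes into covering numbers. Finally the spectrum is at least the box dimension for
any totally bounded set (`le_assouadSpectrum`). -/

theorem coverNum_le_card {ι : Type*} (s : Finset ι) (U : ι → Set E) {r : ℝ} {X : Set E}
    (hU : ∀ i ∈ s, Metric.ediam (U i) ≤ ENNReal.ofReal r) (hX : X ⊆ ⋃ i ∈ s, U i) :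
    coverNum r X ≤ s.card := by
  classical
  refine (iInf₂_le (s.image U) ⟨?_, ?_⟩).trans (Nat.cast_le.2 Finset.card_image_le)
  · simpa using hU
  · simpa using hX

theorem coverNum_mono {r : ℝ} {X Y : Set E} (h : X ⊆ Y) : coverNum r X ≤ coverNum r Y :=
  le_iInf₂ fun U hU => iInf₂_le U ⟨hU.1, h.trans hU.2⟩

theorem coverNum_anti {r r' : ℝ} (h : r ≤ r') (X : Set E) : coverNum r' X ≤ coverNum r X :=
  le_iInf₂ fun U hU => iInf₂_le U
    ⟨fun u hu => (hU.1 u hu).trans (ENNReal.ofReal_le_ofReal h), hU.2⟩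

theorem exists_cover_of_coverNum_ne_top {r : ℝ} {X : Set E} (h : coverNum r X ≠ ⊤) :
    ∃ U : Finset (Set E), (∀ u ∈ U, Metric.ediam u ≤ ENNReal.ofReal r) ∧ X ⊆ ⋃ u ∈ U, u ∧
      (U.card : ℕ∞) = coverNum r X := by
  set P : Finset (Set E) → Prop := fun U =>
    (∀ u ∈ U, Metric.ediam u ≤ ENNReal.ofReal r) ∧ X ⊆ ⋃ u ∈ U, u
  have h1 : coverNum r X = ⨅ U : {U // P U}, (U.1.card : ℕ∞) := iInf_subtype'
  have : Nonempty {U // P U} := by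
    by_contra hcon
    rw [not_nonempty_iff] at hcon
    exact h (by rw [h1, iInf_of_empty])
  obtain ⟨U, hU⟩ := ENat.exists_eq_iInf fun U : {U // P U} => (U.1.card : ℕ∞)
  exact ⟨U.1, U.2.1, U.2.2, by rw [h1]; exact hU⟩

theorem coverNum_empty (r : ℝ) : coverNum r (∅ : Set E) = 0 := by
  have := coverNum_le_card (∅ : Finset Unit) (fun _ => (∅ : Set E)) (r := r) (X := ∅)
    (by simp) (by simp)
  simpa using this

theorem coverNum_ne_zero {r : ℝ} {X : Set E} (hX : X.Nonempty) : coverNum r X ≠ 0 := by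
  intro h
  obtain ⟨U, -, h2, h3⟩ := exists_cover_of_coverNum_ne_top (h ▸ ENat.zero_ne_top)
  rw [h, Nat.cast_eq_zero, Finset.card_eq_zero] at h3
  obtain ⟨x, hx⟩ := hX
  simpa [h3] using h2 hx

theorem coverNum_ne_top {r : ℝ} (hr : 0 < r) {X : Set E} (hX : TotallyBounded X) :
    coverNum r X ≠ ⊤ := by
  obtain ⟨t, ht, hXt⟩ := Metric.totallyBounded_iff.1 hX (r / 2) (by positivity)
  refine ne_top_of_le_ne_top (ENat.natCast_ne_top ht.toFinset.card)
    (coverNum_le_card ht.toFinset (fun y => Metric.ball y (r / 2)) (fun y _ => ?_) (by simpa))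
  refine Metric.ediam_le fun x hx z hz => ?_
  rw [edist_dist]
  refine ENNReal.ofReal_le_ofReal ?_
  have := dist_triangle_right x z y
  rw [Metric.mem_ball] at hx hz
  linarith

theorem localCoverNum_le_coverNum (r R : ℝ) (F : Set E) : localCoverNum r R F ≤ coverNum r F :=
  iSup₂_le fun _ _ => coverNum_mono inter_subset_right

/-- A covering set of diameter at most `R / 2` that meets `F` at `x` has its trace on `F` inside the
open ball `B(x, R)`. Halving `R` is what makes the strict inequality hold. -/
theorem coverNum_le_mul_localCoverNum {r R : ℝ} (hr : 0 < r) (hR : 0 < R) {F : Set E}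
    (hF : TotallyBounded F) :
    coverNum r F ≤ coverNum (R / 2) F * localCoverNum r R F := by
  classical
  obtain ⟨U, hU1, hU2, hU3⟩ :=
    exists_cover_of_coverNum_ne_top (coverNum_ne_top (r := R / 2) (by positivity) hF)
  have hloc : localCoverNum r R F ≠ ⊤ :=
    ne_top_of_le_ne_top (coverNum_ne_top hr hF) (localCoverNum_le_coverNum r R F)
  obtain ⟨m, hm⟩ := ENat.ne_top_iff_exists.1 hloc
  have : ∀ u ∈ U, ∃ V : Finset (Set E), (∀ w ∈ V, Metric.ediam w ≤ ENNReal.ofReal r) ∧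
      u ∩ F ⊆ ⋃ w ∈ V, w ∧ V.card ≤ m := by
    intro u hu
    rcases (u ∩ F).eq_empty_or_nonempty with h0 | ⟨x, hxu, hxF⟩
    · exact ⟨∅, by simp, by simp [h0], by simp⟩
    · have hle : coverNum r (Metric.ball x R ∩ F) ≤ m := by
        rw [hm]; exact le_iSup₂ (f := fun x _ => coverNum r (Metric.ball x R ∩ F)) x hxF
      obtain ⟨V, h1, h2, h3⟩ :=
        exists_cover_of_coverNum_ne_top (ne_top_of_le_ne_top (ENat.natCast_ne_top m) hle)
      refine ⟨V, h1, fun y hy => h2 ⟨?_, hy.2⟩, ?_⟩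
      · have h4 := (Metric.edist_le_ediam_of_mem hy.1 hxu).trans (hU1 u hu)
        rw [edist_dist, ENNReal.ofReal_le_ofReal_iff (by positivity)] at h4
        rw [Metric.mem_ball]; linarith
      · rw [← h3] at hle; exact_mod_cast hle
  choose! V hV1 hV2 hV3 using this
  rw [← hU3, ← hm, ← Nat.cast_mul]
  refine (coverNum_le_card (U.biUnion V) id ?_ ?_).trans
    (Nat.cast_le.2 (Finset.card_biUnion_le_card_mul _ _ _ hV3))
  · intro w hw
    obtain ⟨u, hu, hw⟩ := Finset.mem_biUnion.1 hw
    exact hV1 u hu w hw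
  · intro x hx
    obtain ⟨u, hu, hxu⟩ := mem_iUnion₂.1 (hU2 hx)
    obtain ⟨w, hw, hxw⟩ := mem_iUnion₂.1 (hV2 u hu ⟨hxu, hx⟩)
    exact mem_iUnion₂.2 ⟨w, Finset.mem_biUnion.2 ⟨u, hu, hw⟩, hxw⟩

end Covering

/-! ### Box-counting dimension -/

section BoxDim

variable {E : Type*} [MetricSpace E]

theorem tendsto_neg_log_nhdsGT_zero : Tendsto (fun r : ℝ => -Real.log r) (𝓝[>] 0) atTop :=
  tendsto_neg_atBot_atTop.comp Real.tendsto_log_nhdsGT_zero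

/-- Multiplicative constants disappear after division by `-log r`. Negative exponents need no lower
bound, since the quotient is nonnegative for small `r`. -/
theorem hasBoxDim_of_bounds {F : Set E} {s : ℝ≥0}
    (hN : ∀ᶠ r in 𝓝[>] (0 : ℝ), 1 ≤ (coverNum r F).toNat)
    (hup : ∀ t : ℝ, s < t → ∃ C > 0, ∀ᶠ r in 𝓝[>] (0 : ℝ),
      ((coverNum r F).toNat : ℝ) ≤ C * r ^ (-t))
    (hlow : ∀ t : ℝ, 0 ≤ t → t < s → ∃ C > 0, ∀ᶠ r in 𝓝[>] (0 : ℝ),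
      C * r ^ (-t) ≤ ((coverNum r F).toNat : ℝ)) : HasBoxDim F s := by
  have hpos : ∀ᶠ r in 𝓝[>] (0 : ℝ), 0 < r := self_mem_nhdsWithin
  have hlog := tendsto_neg_log_nhdsGT_zero.eventually_gt_atTop 0
  have hlim : ∀ C t : ℝ, Tendsto (fun r : ℝ => Real.log C / (-Real.log r) + t) (𝓝[>] 0) (𝓝 t) :=
    fun C t => by
      simpa using (tendsto_neg_log_nhdsGT_zero.const_div_atTop (Real.log C)).add_const t
  have hform : ∀ C t r : ℝ, 0 < C → 0 < r → 0 < -Real.log r →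
      Real.log (C * r ^ (-t)) / (-Real.log r) = Real.log C / (-Real.log r) + t := by
    intro C t r hC hr hl
    rw [Real.log_mul hC.ne' (Real.rpow_pos_of_pos hr _).ne', Real.log_rpow hr]
    have : Real.log r ≠ 0 := fun h0 => by simp [h0] at hl
    field_simp
    ring
  refine tendsto_order.2 ⟨fun l hl => ?_, fun u hu => ?_⟩
  · rcases lt_or_ge l 0 with h0 | h0
    · filter_upwards [hlog] with r hr
      exact h0.trans_le (div_nonneg (Real.log_natCast_nonneg _) hr.le)
    · obtain ⟨C, hC, hev⟩ := hlow ((l + s) / 2) (by positivity) (by linarith)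
      filter_upwards [hpos, hlog, hev, (hlim C ((l + s) / 2)).eventually_const_lt
        (by linarith : l < (l + s) / 2)] with r hr hl hle hlt
      refine hlt.trans_le ?_
      rw [← hform C _ r hC hr hl]
      exact div_le_div_of_nonneg_right
        (Real.log_le_log (mul_pos hC (Real.rpow_pos_of_pos hr _)) hle) hl.le
  · obtain ⟨C, hC, hev⟩ := hup ((s + u) / 2) (by linarith)
    filter_upwards [hpos, hlog, hev, hN, (hlim C ((s + u) / 2)).eventually_lt_const
      (by linarith : (s + u) / 2 < u)] with r hr hl hle h1 hlt
    refine lt_of_le_of_lt ?_ hlt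
    rw [← hform C _ r hC hr hl]
    exact div_le_div_of_nonneg_right
      (Real.log_le_log (Nat.cast_pos.2 h1) hle) hl.le

theorem hasBoxDim_empty : HasBoxDim (∅ : Set E) 0 := by
  simp [HasBoxDim, coverNum_empty]

end BoxDim

/-! ### Assouad spectrum -/

section Spectrum

variable {E : Type*} [MetricSpace E]

theorem assouadSpectrum_empty (θ : ℝ) : assouadSpectrum θ (∅ : Set E) = 0 := by
  refine le_antisymm (iInf₂_le (0 : ℝ≥0) ⟨1, one_pos, fun r R _ _ _ => ?_⟩) zero_le
  simp [localCoverNum]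

/-- Only small `r` matter. For `r ≥ r₀` the covering number is bounded by the finite value at `r₀`,
while `R ≤ |F|` forces `r ≤ |F| ^ (1 / θ)` and so keeps `(R / r) ^ α` above a positive constant. -/
theorem assouadSpectrum_le {F : Set E} (hF : TotallyBounded F) {θ : ℝ}
    (hθ : θ ∈ Ioo (0 : ℝ) 1) {s : ℝ≥0}
    (h : ∀ α : ℝ≥0, s < α → ∃ C r₀ : ℝ, 0 < C ∧ 0 < r₀ ∧ ∀ r : ℝ, 0 < r → r < r₀ →
      (localCoverNum r (r ^ θ) F : ℝ≥0∞) ≤ ENNReal.ofReal (C * (r ^ θ / r) ^ (α : ℝ))) :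
    assouadSpectrum θ F ≤ s := by
  refine le_of_forall_gt_imp_ge_of_dense fun β hβ => ?_
  obtain ⟨α, hsα, hαβ⟩ := ENNReal.lt_iff_exists_nnreal_btwn.1 hβ
  refine le_trans ?_ hαβ.le
  obtain ⟨C, r₀, hC, hr₀, hsmall⟩ := h α (by exact_mod_cast hsα)
  obtain ⟨m, hm⟩ := ENat.ne_top_iff_exists.1 (coverNum_ne_top hr₀ hF)
  set D := Metric.diam F ^ (1 / θ)
  set X := (D ^ (θ - 1)) ^ (α : ℝ)
  refine iInf₂_le α ⟨max C (m / X), lt_max_of_lt_left hC, ?_⟩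
  rintro r _ hr rfl hR
  have hq : 0 ≤ (r ^ θ / r) ^ (α : ℝ) := by positivity
  rcases lt_or_ge r r₀ with h1 | h1
  · refine (hsmall r hr h1).trans (ENNReal.ofReal_le_ofReal ?_)
    exact mul_le_mul_of_nonneg_right (le_max_left _ _) hq
  · have hrD : r ≤ D := by
      have := Real.rpow_le_rpow (by positivity) hR (one_div_nonneg.2 hθ.1.le)
      rwa [← Real.rpow_mul hr.le, mul_one_div, div_self hθ.1.ne', Real.rpow_one] at this
    have hD : 0 < D := hr.trans_le hrD
    have hX : 0 < X := by positivity
    have hXq : X ≤ (r ^ θ / r) ^ (α : ℝ) := by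
      have h2 : r ^ θ / r = r ^ (θ - 1) := by rw [Real.rpow_sub_one hr.ne']
      rw [h2]
      exact Real.rpow_le_rpow (by positivity)
        (Real.rpow_le_rpow_of_nonpos hr hrD (by linarith [hθ.2])) α.2
    have h3 : localCoverNum r (r ^ θ) F ≤ m := by
      rw [hm]; exact (localCoverNum_le_coverNum _ _ _).trans (coverNum_anti h1 F)
    have h4 : (localCoverNum r (r ^ θ) F : ℝ≥0∞) ≤ ((m : ℕ∞) : ℝ≥0∞) := ENat.toENNReal_le.2 h3
    refine h4.trans ?_
    rw [ENat.toENNReal_coe, ← ENNReal.ofReal_natCast]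
    refine ENNReal.ofReal_le_ofReal ?_
    calc (m : ℝ) = m / X * X := by field_simp
      _ ≤ max C (m / X) * (r ^ θ / r) ^ (α : ℝ) :=
        mul_le_mul (le_max_right _ _) hXq hX.le (le_max_of_le_left hC.le)

/-- With `R = r ^ θ`, taking logarithms in `N_r ≤ N_{R/2} * N_{r,R}` gives `s ≤ s * θ + α * (1 -
θ)`, that is `s ≤ α`. Sets with at most one point are separate, because for diameter `0` no scale is
admissible. -/
theorem le_assouadSpectrum {F : Set E} (hF : TotallyBounded F) {s : ℝ≥0} (hs : HasBoxDim F s)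
    {θ : ℝ} (hθ : θ ∈ Ioo (0 : ℝ) 1) : (s : ℝ≥0∞) ≤ assouadSpectrum θ F := by
  refine le_iInf₂ fun α => ?_
  rintro ⟨C, hC, hα⟩
  rw [ENNReal.coe_le_coe]
  rcases F.subsingleton_or_nontrivial with hsub | hnt
  · have h0 : (fun r : ℝ => Real.log ((coverNum r F).toNat : ℝ) / (-Real.log r)) = fun _ => 0 := by
      funext r
      have h1 : coverNum r F ≤ 1 := by
        simpa using coverNum_le_card ({()} : Finset Unit) (fun _ => F) (r := r)
          (by simp [Metric.ediam_subsingleton hsub]) 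
            fun x hx => mem_iUnion₂.2 ⟨(), Finset.mem_singleton_self _, hx⟩
      have h2 : (coverNum r F).toNat ≤ 1 := ENat.toNat_le_of_le_natCast (by exact_mod_cast h1)
      interval_cases (coverNum r F).toNat <;> simp
    have h1 : Tendsto (fun _ : ℝ => (0 : ℝ)) (𝓝[>] 0) (𝓝 (s : ℝ)) := h0 ▸ hs
    have h2 : (0 : ℝ) = s := tendsto_nhds_unique tendsto_const_nhds h1
    exact NNReal.coe_le_coe.1 (h2 ▸ α.2)
  have hdiam : 0 < Metric.diam F := by
    obtain ⟨x, hx, y, hy, hxy⟩ := hnt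
    exact (dist_pos.2 hxy).trans_le (Metric.dist_le_diam_of_mem hF.isBounded hx hy)
  have hpos : ∀ᶠ r in 𝓝[>] (0 : ℝ), 0 < r := self_mem_nhdsWithin
  have hlog := tendsto_neg_log_nhdsGT_zero.eventually_gt_atTop 0
  have hpow : Tendsto (fun r : ℝ => r ^ θ) (𝓝[>] 0) (𝓝 0) := by
    have := (Real.continuousAt_rpow_const 0 θ (Or.inr hθ.1.le)).tendsto
    rw [Real.zero_rpow hθ.1.ne'] at this
    exact this.mono_left nhdsWithin_le_nhds
  have hρ : Tendsto (fun r : ℝ => r ^ θ / 2) (𝓝[>] 0) (𝓝[>] 0) := by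
    refine tendsto_nhdsWithin_iff.2 ⟨by simpa using hpow.div_const 2, ?_⟩
    filter_upwards [hpos] with r hr
    exact div_pos (Real.rpow_pos_of_pos hr θ) two_pos
  set N : ℝ → ℝ := fun r => ((coverNum r F).toNat : ℝ)
  have hN1 : ∀ r, 0 < r → 1 ≤ N r := fun r hr => by
    have : 1 ≤ (coverNum r F).toNat := Nat.one_le_iff_ne_zero.2 fun h0 => by
      rcases ENat.toNat_eq_zero.1 h0 with h | h
      · exact coverNum_ne_zero hnt.nonempty h
      · exact coverNum_ne_top hr hF h
    exact Nat.one_le_cast.2 this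
  -- The logarithm of the upper bound for `N r`, divided by `-log r`. The first term is written
  -- through `-log (r ^ θ / 2) = -log r * (θ + log 2 / (-log r))`, so that the box dimension at
  -- scale `r ^ θ / 2` applies.
  have hlim : Tendsto (fun r : ℝ => Real.log (N (r ^ θ / 2)) / (-Real.log (r ^ θ / 2)) *
      (θ + Real.log 2 / (-Real.log r)) + Real.log C / (-Real.log r) + α * (1 - θ)) (𝓝[>] 0)
      (𝓝 (s * (θ + 0) + 0 + α * (1 - θ))) :=
    (((hs.comp hρ).mul ((tendsto_neg_log_nhdsGT_zero.const_div_atTop (Real.log 2)).const_add θ)).add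
      (tendsto_neg_log_nhdsGT_zero.const_div_atTop (Real.log C))).add_const _
  have hle : (s : ℝ) ≤ s * (θ + 0) + 0 + α * (1 - θ) := by
    refine le_of_tendsto_of_tendsto hs hlim ?_
    have hlogρ := (tendsto_neg_log_nhdsGT_zero.comp hρ).eventually_gt_atTop 0
    filter_upwards [hpos, hlog, hlogρ, hpow.eventually_le_const hdiam] with r hr hl hlρ hR
    have hRpos : 0 < r ^ θ := Real.rpow_pos_of_pos hr θ
    have h1 := coverNum_le_mul_localCoverNum hr hRpos hF
    have h2 := hα r (r ^ θ) hr rfl hR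
    have hq : 0 < (r ^ θ / r) ^ (α : ℝ) := Real.rpow_pos_of_pos (div_pos hRpos hr) _
    have h3 : N r ≤ N (r ^ θ / 2) * (C * (r ^ θ / r) ^ (α : ℝ)) := by
      have h4 : (coverNum r F : ℝ≥0∞) ≤ (coverNum (r ^ θ / 2) F : ℝ≥0∞) *
          ENNReal.ofReal (C * (r ^ θ / r) ^ (α : ℝ)) := by
        have := ENat.toENNReal_le.2 h1
        rw [ENat.toENNReal_mul] at this
        exact this.trans (mul_le_mul_right h2 _)
      rw [← ENat.natCast_toNat (coverNum_ne_top hr hF),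
        ← ENat.natCast_toNat (coverNum_ne_top (by positivity : 0 < r ^ θ / 2) hF),
        ENat.toENNReal_coe, ENat.toENNReal_coe, ← ENNReal.ofReal_natCast, ← ENNReal.ofReal_natCast,
        ← ENNReal.ofReal_mul (by positivity), ENNReal.ofReal_le_ofReal_iff (by positivity)] at h4
      exact h4
    have hNρ : 0 < N (r ^ θ / 2) := one_pos.trans_le (hN1 _ (by positivity))
    have h5 := Real.log_le_log (one_pos.trans_le (hN1 r hr)) h3
    rw [Real.log_mul hNρ.ne' (by positivity), Real.log_mul hC.ne' hq.ne',
      Real.log_rpow (by positivity), Real.log_div hRpos.ne' hr.ne', Real.log_rpow hr] at h5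
    have h6 := div_le_div_of_nonneg_right h5 hl.le
    refine h6.trans_eq ?_
    have h7 : Real.log (r ^ θ / 2) = θ * Real.log r - Real.log 2 := by
      rw [Real.log_div hRpos.ne' two_ne_zero, Real.log_rpow hr]
    have h8 : -Real.log (r ^ θ / 2) = -Real.log r * (θ + Real.log 2 / (-Real.log r)) := by
      rw [h7, mul_add, mul_div_cancel₀ _ hl.ne']; ring
    have h9 : θ + Real.log 2 / (-Real.log r) ≠ 0 := by
      intro h0
      have h10 : -Real.log (r ^ θ / 2) ≠ 0 := hlρ.ne'
      rw [h8, h0, mul_zero] at h10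
      exact h10 rfl
    rw [h8]
    generalize θ + Real.log 2 / (-Real.log r) = w at h9
    have h11 : Real.log r ≠ 0 := fun h0 => by simp [h0] at hl
    field_simp
    ring
  have h1 : 0 < 1 - θ := by linarith [hθ.2]
  have h2 : (s : ℝ) * (1 - θ) ≤ α * (1 - θ) := by linarith
  exact NNReal.coe_le_coe.1 (le_of_mul_le_mul_right h2 h1)

end Spectrum

/-! ### Independence and self-similarity of the random labelling -/

namespace RIFS

variable {d k : ℕ}

attribute [instance] RIFS.isProb

instance (S : RIFS d k) : IsProbabilityMeasure S.prob := by
  unfold RIFS.prob; infer_instance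

/-- The labelling with root label `p.1` and labellings `p.2 i` of the subtrees at the children. -/
def join (S : RIFS d k) (p : S.Λ × (Fin S.maxN → S.Labelling)) : S.Labelling
  | [] => p.1
  | i :: v => p.2 i v

theorem measurable_join (S : RIFS d k) : Measurable S.join := by
  refine measurable_pi_lambda _ fun v => ?_
  cases v with
  | nil => exact measurable_fst
  | cons i v =>
    exact (measurable_pi_apply v).comp ((measurable_pi_apply i).comp measurable_snd)

theorem measurable_root (S : RIFS d k) : Measurable fun τ : S.Labelling => τ [] :=
  measurable_pi_apply _

theorem measurable_shift (S : RIFS d k) (i : Fin S.maxN) :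
    Measurable fun τ : S.Labelling => S.shift τ i :=
  measurable_pi_lambda _ fun _ => measurable_pi_apply _

theorem prod_list_eq_mul_prod {M : ℕ} (s : Finset (List (Fin M))) (g : List (Fin M) → ℝ≥0∞) :
    ∏ v ∈ s, g v = (∏ v ∈ s with v = [], g v) *
      ∏ i, ∏ v ∈ s.preimage (List.cons i) List.cons_injective.injOn, g (i :: v) := by
  classical
  rw [← Finset.prod_fiberwise s List.head? g, Fintype.prod_option]
  congr 1
  · refine Finset.prod_congr ?_ fun _ _ => rfl
    ext v; simp
  · refine Finset.prod_congr rfl fun i _ => ?_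
    symm
    refine Finset.prod_bij (fun v _ => i :: v) ?_ ?_ ?_ ?_
    · intro v hv; simpa using hv
    · intro v _ w _ h; exact List.cons_injective h
    · intro v hv
      cases v with
      | nil => simp at hv
      | cons j w =>
        simp only [Finset.mem_filter, List.head?_cons, Option.some.injEq] at hv
        obtain ⟨h1, rfl⟩ := hv
        exact ⟨w, by simpa using h1, rfl⟩
    · intro v _; rfl

/-- A product measure is determined on finite cylinders, and a cylinder splits into a condition at
the root and, for each first letter, a cylinder in the subtree of that child. -/
theorem map_join_prob (S : RIFS d k) :
    (S.μ.prod (Measure.pi fun _ : Fin S.maxN => S.prob)).map S.join = S.prob := by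
  classical
  refine Measure.eq_infinitePi _ fun s t ht => ?_
  have hms : MeasurableSet (Set.pi (s : Set (List (Fin S.maxN))) t) :=
    MeasurableSet.pi s.countable_toSet fun v _ => ht v
  rw [Measure.map_apply S.measurable_join hms]
  have hpre : S.join ⁻¹' (Set.pi (s : Set (List (Fin S.maxN))) t) =
      (Set.pi ((s.filter (· = []) : Finset _) : Set (List (Fin S.maxN))) fun v => t v).preimage
        (fun l _ => l) ×ˢ
      Set.pi Set.univ fun i => Set.pi ((s.preimage (List.cons i)
        List.cons_injective.injOn : Finset _) : Set (List (Fin S.maxN)))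
          fun v => t (i :: v) := by
    ext p
    simp only [Set.mem_preimage, Set.mem_pi, Set.mem_prod, Finset.mem_coe, Finset.mem_filter,
      Set.mem_univ, true_implies, Finset.mem_preimage]
    constructor
    · intro h
      refine ⟨fun v hv => ?_, fun i v hv => h _ hv⟩
      obtain ⟨h1, rfl⟩ := hv
      exact h _ h1
    · rintro ⟨h1, h2⟩ v hv
      cases v with
      | nil => exact h1 [] ⟨hv, rfl⟩
      | cons i v => exact h2 i v hv
  rw [hpre, Measure.prod_prod, Measure.pi_pi, prod_list_eq_mul_prod]
  congr 1
  · by_cases h : [] ∈ s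
    · have : s.filter (· = []) = {[]} := by
        ext v; simp only [Finset.mem_filter, Finset.mem_singleton]
        constructor
        · exact fun h => h.2
        · rintro rfl; exact ⟨h, rfl⟩
      rw [this]; simp [Set.preimage]
    · have : s.filter (· = []) = ∅ := by
        ext v; simp only [Finset.mem_filter, Finset.notMem_empty, iff_false]
        rintro ⟨h1, rfl⟩; exact h h1
      rw [this]; simp
  · refine Finset.prod_congr rfl fun i _ => ?_
    exact Measure.infinitePi_pi _ fun v _ => ht _

theorem lintegral_pi_prod {ι : Type*} [Fintype ι] {X : Type*} [MeasurableSpace X] (P : Measure X)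
    [IsProbabilityMeasure P] (g : ι → X → ℝ≥0∞) (hg : ∀ i, Measurable (g i)) :
    ∫⁻ σ, ∏ i, g i (σ i) ∂(Measure.pi fun _ : ι => P) = ∏ i, ∫⁻ x, g i x ∂P := by
  rw [ProbabilityTheory.lintegral_prod_eq_prod_lintegral_of_indepFun Finset.univ
    (fun i (σ : ι → X) => g i (σ i))
    (ProbabilityTheory.iIndepFun_pi (μ := fun _ : ι => P) fun i => (hg i).aemeasurable)
    fun i => (hg i).comp (measurable_pi_apply i)]
  refine Finset.prod_congr rfl fun i _ => ?_
  exact (measurePreserving_eval (fun _ : ι => P) i).lintegral_comp (hg i)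

/-- The root label and the labellings of the subtrees at the children are independent. -/
theorem lintegral_prob_prod (S : RIFS d k) (F : S.Labelling → ℝ≥0∞) (hF : Measurable F)
    (g : S.Λ → Fin S.maxN → S.Labelling → ℝ≥0∞) (hg : ∀ l i, Measurable (g l i))
    (h : ∀ τ, F τ = ∏ i, g (τ []) i (S.shift τ i)) :
    ∫⁻ τ, F τ ∂S.prob = ∫⁻ l, ∏ i, ∫⁻ τ, g l i τ ∂S.prob ∂S.μ := by
  conv_lhs => rw [← S.map_join_prob]
  rw [lintegral_map hF S.measurable_join,
    lintegral_prod (fun p => F (S.join p)) (hF.comp S.measurable_join).aemeasurable]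
  refine lintegral_congr fun l => ?_
  rw [← lintegral_pi_prod S.prob (g l) (hg l)]
  refine lintegral_congr fun σ => ?_
  rw [h]
  rfl

theorem map_shift_prob (S : RIFS d k) (i : Fin S.maxN) :
    S.prob.map (fun τ => S.shift τ i) = S.prob := by
  conv_lhs => rw [← S.map_join_prob]
  rw [Measure.map_map (S.measurable_shift i) S.measurable_join]
  have : (fun τ => S.shift τ i) ∘ S.join = (fun σ => σ i) ∘ Prod.snd := rfl
  rw [this, ← Measure.map_map (measurable_pi_apply i) measurable_snd, Measure.map_snd_prod]
  simp only [measure_univ, one_smul]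
  exact (measurePreserving_eval (fun _ : Fin S.maxN => S.prob) i).map_eq

/-- The labelling of the full subtree that starts at the node `v`. -/
def sub (S : RIFS d k) (τ : S.Labelling) (v : List (Fin S.maxN)) : S.Labelling :=
  fun w => τ (v ++ w)

@[simp] theorem sub_nil (S : RIFS d k) (τ : S.Labelling) : S.sub τ [] = τ := rfl

theorem sub_cons (S : RIFS d k) (τ : S.Labelling) (i : Fin S.maxN) (v : List (Fin S.maxN)) :
    S.sub τ (i :: v) = S.sub (S.shift τ i) v := rfl

theorem sub_append (S : RIFS d k) (τ : S.Labelling) (v w : List (Fin S.maxN)) :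
    S.sub τ (v ++ w) = S.sub (S.sub τ v) w := by
  funext u; simp [sub]

theorem measurable_sub (S : RIFS d k) (v : List (Fin S.maxN)) :
    Measurable fun τ : S.Labelling => S.sub τ v :=
  measurable_pi_lambda _ fun _ => measurable_pi_apply _

theorem map_sub_prob (S : RIFS d k) (v : List (Fin S.maxN)) :
    S.prob.map (fun τ => S.sub τ v) = S.prob := by
  induction v with
  | nil => exact Measure.map_id
  | cons i v ih =>
    have : (fun τ => S.sub τ (i :: v)) = (fun τ => S.sub τ v) ∘ fun τ => S.shift τ i := rfl
    rw [this, ← Measure.map_map (S.measurable_sub v) (S.measurable_shift i), map_shift_prob, ih]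

theorem prob_sub_mem (S : RIFS d k) (v : List (Fin S.maxN)) {A : Set S.Labelling}
    (hA : MeasurableSet A) : S.prob {τ | S.sub τ v ∈ A} = S.prob A := by
  conv_rhs => rw [← S.map_sub_prob v, Measure.map_apply (S.measurable_sub v) hA]
  rfl

end RIFS

/-! ### Stopping lines -/

namespace RIFS

variable {d k : ℕ}

/-- `c` is a measurable system of ratios with values in `[a, b] ⊆ (0, 1)`. -/
structure IsRatio (S : RIFS d k) (c : S.Λ → Fin S.maxN → ℝ) (a b : ℝ) : Prop where
  pos : 0 < a
  ab : a ≤ b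
  lt_one : b < 1
  ge : ∀ l i, a ≤ c l i
  le : ∀ l i, c l i ≤ b
  meas : ∀ i, Measurable fun l => c l i

/-- The product of the ratios along the coding of a node. -/
def cratio (S : RIFS d k) (c : S.Λ → Fin S.maxN → ℝ) : S.Labelling → List (Fin S.maxN) → ℝ
  | _, [] => 1
  | τ, i :: v => c (τ []) i * S.cratio c (S.shift τ i) v

/-- The node `v` belongs to the stopping line where the ratio first drops to `ξ` or below. -/
def InCut (S : RIFS d k) (c : S.Λ → Fin S.maxN → ℝ) :
    ℝ → S.Labelling → List (Fin S.maxN) → Prop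
  | ξ, _, [] => 1 ≤ ξ
  | ξ, τ, i :: v => ξ < 1 ∧ (i : ℕ) < S.N (τ []) ∧
      S.InCut c (ξ / c (τ []) i) (S.shift τ i) v

/-- The nodes of the stopping line at `ξ` whose subtree labelling lies in `D`. -/
def cutSet (S : RIFS d k) (c : S.Λ → Fin S.maxN → ℝ) (D : Set S.Labelling) (ξ : ℝ)
    (τ : S.Labelling) : Set (List (Fin S.maxN)) :=
  {v | S.InCut c ξ τ v ∧ S.sub τ v ∈ D}

/-- The number of nodes of the stopping line at `ξ` whose subtree labelling lies in `D`. -/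
noncomputable def cutCount (S : RIFS d k) (c : S.Λ → Fin S.maxN → ℝ) (D : Set S.Labelling) (ξ : ℝ)
    (τ : S.Labelling) : ℕ :=
  (S.cutSet c D ξ τ).ncard

variable {S : RIFS d k} {c : S.Λ → Fin S.maxN → ℝ} {a b : ℝ}

namespace IsRatio

theorem c_pos (h : S.IsRatio c a b) (l : S.Λ) (i : Fin S.maxN) : 0 < c l i :=
  h.pos.trans_le (h.ge l i)

theorem c_lt_one (h : S.IsRatio c a b) (l : S.Λ) (i : Fin S.maxN) : c l i < 1 :=
  (h.le l i).trans_lt h.lt_one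

end IsRatio

theorem cratio_pos (h : S.IsRatio c a b) (τ : S.Labelling) (v : List (Fin S.maxN)) :
    0 < S.cratio c τ v := by
  induction v generalizing τ with
  | nil => exact one_pos
  | cons i v ih => exact mul_pos (h.c_pos _ _) (ih _)

theorem cratio_le_one (h : S.IsRatio c a b) (τ : S.Labelling) (v : List (Fin S.maxN)) :
    S.cratio c τ v ≤ 1 := by
  induction v generalizing τ with
  | nil => exact le_rfl
  | cons i v ih => exact mul_le_one₀ (h.c_lt_one _ _).le (cratio_pos h _ _).le (ih _)

theorem cratio_append (τ : S.Labelling) (v w : List (Fin S.maxN)) :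
    S.cratio c τ (v ++ w) = S.cratio c τ v * S.cratio c (S.sub τ v) w := by
  induction v generalizing τ with
  | nil => simp [cratio]
  | cons i v ih => simp only [List.cons_append, cratio, ih, sub_cons, mul_assoc]

theorem isCoding_append (τ : S.Labelling) (v w : List (Fin S.maxN)) :
    S.IsCoding τ (v ++ w) ↔ S.IsCoding τ v ∧ S.IsCoding (S.sub τ v) w := by
  induction v generalizing τ with
  | nil => simp [IsCoding]
  | cons i v ih => simp only [List.cons_append, IsCoding, ih, sub_cons, and_assoc]

theorem codingMap_append (τ : S.Labelling) (v w : List (Fin S.maxN)) :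
    S.codingMap τ (v ++ w) = S.codingMap τ v ∘ S.codingMap (S.sub τ v) w := by
  induction v generalizing τ with
  | nil => rfl
  | cons i v ih => simp only [List.cons_append, codingMap, ih, sub_cons, Function.comp_assoc]

theorem InCut.isCoding {ξ : ℝ} {τ : S.Labelling} {v : List (Fin S.maxN)}
    (h : S.InCut c ξ τ v) : S.IsCoding τ v := by
  induction v generalizing τ ξ with
  | nil => trivial
  | cons i v ih => exact ⟨h.2.1, ih h.2.2⟩

theorem InCut.eq_nil {ξ : ℝ} (hξ : 1 ≤ ξ) {τ : S.Labelling} {v : List (Fin S.maxN)}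
    (h : S.InCut c ξ τ v) : v = [] := by
  cases v with
  | nil => rfl
  | cons i v => exact absurd h.1 hξ.not_gt

/-- Drives the inductions along stopping lines: passing to a child divides `ξ` by a ratio at most
`b`, so the number of generations still needed drops by one. -/
theorem pow_le_div (h : S.IsRatio c a b) {ξ : ℝ} {n : ℕ} (hξ : b ^ (n + 1) ≤ ξ) (l : S.Λ)
    (i : Fin S.maxN) : b ^ n ≤ ξ / c l i := by
  rw [le_div_iff₀ (h.c_pos _ _)]
  refine le_trans ?_ hξ
  rw [pow_succ]
  have hb : 0 ≤ b := (h.c_pos l i).le.trans (h.le l i)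
  exact mul_le_mul_of_nonneg_left (h.le _ _) (pow_nonneg hb _)

theorem InCut.length_le (h : S.IsRatio c a b) {ξ : ℝ} {n : ℕ} (hξ : b ^ n ≤ ξ) {τ : S.Labelling}
    {v : List (Fin S.maxN)} (hv : S.InCut c ξ τ v) : v.length ≤ n := by
  induction v generalizing τ ξ n with
  | nil => exact Nat.zero_le _
  | cons i v ih =>
    cases n with
    | zero => exact absurd hv.1 (by simpa using hξ)
    | succ n => exact Nat.succ_le_succ (ih (pow_le_div h hξ _ _) hv.2.2)

theorem cutSet_finite (h : S.IsRatio c a b) (D : Set S.Labelling) {ξ : ℝ} (hξ : 0 < ξ)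
    (τ : S.Labelling) : (S.cutSet c D ξ τ).Finite := by
  obtain ⟨n, hn⟩ := exists_pow_lt_of_lt_one hξ h.lt_one
  exact (List.finite_length_le (Fin S.maxN) n).subset fun v hv => hv.1.length_le h hn.le

theorem cutCount_of_one_le_mem {D : Set S.Labelling} {ξ : ℝ} (hξ : 1 ≤ ξ) {τ : S.Labelling}
    (hτ : τ ∈ D) : S.cutCount c D ξ τ = 1 := by
  have : S.cutSet c D ξ τ = {[]} := by
    ext v
    constructor
    · exact fun hv => hv.1.eq_nil hξ
    · rintro rfl; exact ⟨hξ, hτ⟩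
  rw [cutCount, this, Set.ncard_singleton]

theorem cutCount_of_one_le_notMem {D : Set S.Labelling} {ξ : ℝ} (hξ : 1 ≤ ξ) {τ : S.Labelling}
    (hτ : τ ∉ D) : S.cutCount c D ξ τ = 0 := by
  have : S.cutSet c D ξ τ = ∅ := by
    ext v
    simp only [mem_empty_iff_false, iff_false]
    intro hv
    obtain rfl := hv.1.eq_nil hξ
    exact hτ hv.2
  rw [cutCount, this, Set.ncard_empty]

/-- The branching recursion: below scale `1` the root is not in the line, and the line is the
disjoint union of the lines of the children at the rescaled threshold. -/
theorem cutCount_of_lt_one (h : S.IsRatio c a b) (D : Set S.Labelling) {ξ : ℝ} (h0 : 0 < ξ)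
    (h1 : ξ < 1) (τ : S.Labelling) :
    S.cutCount c D ξ τ = ∑ i : Fin S.maxN, if (i : ℕ) < S.N (τ []) then
      S.cutCount c D (ξ / c (τ []) i) (S.shift τ i) else 0 := by
  have hU : S.cutSet c D ξ τ = ⋃ i : Fin S.maxN, if (i : ℕ) < S.N (τ []) then
      List.cons i '' S.cutSet c D (ξ / c (τ []) i) (S.shift τ i) else ∅ := by
    ext v
    simp only [mem_iUnion]
    constructor
    · intro hv
      cases v with
      | nil => exact absurd hv.1 h1.not_ge
      | cons i v =>
        refine ⟨i, ?_⟩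
        rw [if_pos hv.1.2.1]
        exact ⟨v, ⟨hv.1.2.2, hv.2⟩, rfl⟩
    · rintro ⟨i, hi⟩
      split_ifs at hi with hN
      · obtain ⟨v, hv, rfl⟩ := hi
        exact ⟨⟨h1, hN, hv.1⟩, hv.2⟩
      · exact hi.elim
  rw [cutCount, hU, Set.ncard_iUnion_of_finite]
  · rw [finsum_eq_sum_of_fintype]
    refine Finset.sum_congr rfl fun i _ => ?_
    split_ifs
    · exact Set.ncard_image_of_injective _ List.cons_injective
    · exact Set.ncard_empty _
  · intro i
    split_ifs
    · exact (cutSet_finite h D (div_pos h0 (h.c_pos _ _)) _).image _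
    · exact Set.finite_empty
  · intro i j hij
    refine Set.disjoint_left.2 fun v hv hw => ?_
    dsimp only at hv hw
    split_ifs at hv hw
    · obtain ⟨v, -, rfl⟩ := hv
      obtain ⟨w, -, hw⟩ := hw
      simp only [List.cons.injEq] at hw
      exact hij hw.1.symm
    all_goals simp_all

theorem measurableSet_inCut (h : S.IsRatio c a b) {X : Type*} [MeasurableSpace X] {g : X → ℝ}
    (hg : Measurable g) {T : X → S.Labelling} (hT : Measurable T) (v : List (Fin S.maxN)) :
    MeasurableSet {x | S.InCut c (g x) (T x) v} := by
  induction v generalizing g T with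
  | nil => exact measurableSet_le measurable_const hg
  | cons i v ih =>
    have hr : Measurable fun x => T x [] := (measurable_pi_apply _).comp hT
    refine (measurableSet_lt hg measurable_const).inter (MeasurableSet.inter ?_ ?_)
    · exact (S.measurable_N.comp hr) (measurableSet_Ioi (a := (i : ℕ)))
    · exact ih (hg.div ((h.meas i).comp hr)) ((S.measurable_shift i).comp hT)

theorem measurable_cutCount (h : S.IsRatio c a b) {D : Set S.Labelling} (hD : MeasurableSet D)
    {ξ : ℝ} (hξ : 0 < ξ) : Measurable fun τ => S.cutCount c D ξ τ := by
  classical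
  obtain ⟨n, hn⟩ := exists_pow_lt_of_lt_one hξ h.lt_one
  set L := (List.finite_length_le (Fin S.maxN) n).toFinset
  have : (fun τ => S.cutCount c D ξ τ) = fun τ => ∑ v ∈ L,
      if S.InCut c ξ τ v ∧ S.sub τ v ∈ D then 1 else 0 := by
    funext τ
    rw [cutCount, ← Finset.card_filter, ← Set.ncard_coe_finset]
    congr 1
    ext v
    simp only [Finset.coe_filter, mem_ofPred_eq, cutSet, L, Set.Finite.mem_toFinset]
    exact ⟨fun hv => ⟨hv.1.length_le h hn.le, hv⟩, fun hv => hv.2⟩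
  rw [this]
  refine Finset.measurable_sum _ fun v _ => Measurable.ite ?_ measurable_const measurable_const
  exact (measurableSet_inCut h measurable_const measurable_id v).inter (S.measurable_sub v hD)

theorem measurableSet_isCoding (v : List (Fin S.maxN)) :
    MeasurableSet {τ | S.IsCoding τ v} := by
  induction v with
  | nil => exact MeasurableSet.univ
  | cons i v ih =>
    exact ((S.measurable_N.comp S.measurable_root) (measurableSet_Ioi (a := (i : ℕ)))).inter
      (S.measurable_shift i ih)

/-- The parent of a stopped node still has ratio above `ξ`, and the last step costs at most a factor
`a`. The root, of ratio `1`, is stopped only when `ξ = 1`. -/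
theorem InCut.cratio_bounds (h : S.IsRatio c a b) {ξ : ℝ} (hξ : 0 < ξ) (hξ1 : ξ ≤ 1)
    {τ : S.Labelling} {v : List (Fin S.maxN)} (hv : S.InCut c ξ τ v) :
    a * ξ < S.cratio c τ v ∧ S.cratio c τ v ≤ ξ := by
  induction v generalizing τ ξ with
  | nil =>
    obtain rfl : ξ = 1 := le_antisymm hξ1 hv
    exact ⟨by simpa [cratio] using h.ab.trans_lt h.lt_one, le_rfl⟩
  | cons i v ih =>
    have hc := h.c_pos (τ []) i
    simp only [cratio]
    rcases le_total 1 (ξ / c (τ []) i) with h1 | h1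
    · obtain rfl := InCut.eq_nil h1 hv.2.2
      simp only [cratio, mul_one]
      exact ⟨(mul_lt_of_lt_one_right h.pos hv.1).trans_le (h.ge _ _), (one_le_div hc).1 h1⟩
    · obtain ⟨h2, h3⟩ := ih (div_pos hξ hc) h1 hv.2.2
      rw [← mul_div_assoc, div_lt_iff₀ hc] at h2
      rw [le_div_iff₀ hc] at h3
      exact ⟨by linarith, by linarith⟩

theorem InCut.append (h : S.IsRatio c a b) {ξ : ℝ} {τ : S.Labelling} {v w : List (Fin S.maxN)}
    (hv : S.IsCoding τ v) (hξ : ξ < S.cratio c τ v)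
    (hw : S.InCut c (ξ / S.cratio c τ v) (S.sub τ v) w) : S.InCut c ξ τ (v ++ w) := by
  induction v generalizing τ ξ with
  | nil => simpa [cratio] using hw
  | cons i v ih =>
    have hc := h.c_pos (τ []) i
    refine ⟨hξ.trans_le (cratio_le_one h _ _), hv.1, ih hv.2 ?_ ?_⟩
    · rw [div_lt_iff₀ hc, mul_comm]; exact hξ
    · rw [div_div]; exact hw

theorem exists_inCut_prefix (h : S.IsRatio c a b) {ξ : ℝ} {n : ℕ} (hξ : b ^ n ≤ ξ)
    {τ : S.Labelling} {u : List (Fin S.maxN)} (hu : S.IsCoding τ u) (hn : n ≤ u.length) :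
    ∃ v w, u = v ++ w ∧ S.InCut c ξ τ v := by
  induction u generalizing τ ξ n with
  | nil =>
    obtain rfl : n = 0 := by simpa using hn
    exact ⟨[], [], rfl, by simpa [InCut] using hξ⟩
  | cons i u ih =>
    by_cases h1 : 1 ≤ ξ
    · exact ⟨[], i :: u, rfl, h1⟩
    · cases n with
      | zero => exact absurd (by simpa using hξ) h1
      | succ n =>
        obtain ⟨v, w, rfl, hv⟩ := ih (pow_le_div h hξ (τ []) i) hu.2 (by simpa using hn)
        exact ⟨i :: v, w, rfl, not_le.1 h1, hu.1, hv⟩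

end RIFS

/-! ### Exponential moments of the node counts -/

namespace RIFS

variable {d k : ℕ}

/-- The sum of the `t`-th powers of the ratios of the maps of the system with parameter `l`. -/
noncomputable def ratioSum (S : RIFS d k) (c : S.Λ → Fin S.maxN → ℝ) (t : ℝ) (l : S.Λ) : ℝ :=
  ∑ i : Fin S.maxN, if (i : ℕ) < S.N l then c l i ^ t else 0

/-- The expected sum of the `t`-th powers of the ratios. -/
noncomputable def meanSum (S : RIFS d k) (c : S.Λ → Fin S.maxN → ℝ) (t : ℝ) : ℝ :=
  ∫ l, S.ratioSum c t l ∂S.μ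

/-- The range of parameters in which the exponential of `ratioSum` is controlled linearly. -/
noncomputable def expRange (S : RIFS d k) (c : S.Λ → Fin S.maxN → ℝ) (t : ℝ) : ℝ :=
  min (1 / (S.maxN + 1)) (|1 - S.meanSum c t| / (S.maxN + 1) ^ 2)

variable {S : RIFS d k} {c : S.Λ → Fin S.maxN → ℝ} {a b : ℝ}

theorem measurableSet_lt_N (S : RIFS d k) (i : Fin S.maxN) :
    MeasurableSet {l : S.Λ | (i : ℕ) < S.N l} :=
  S.measurable_N (measurableSet_Ioi (a := (i : ℕ)))

theorem measurable_ratioSum (h : S.IsRatio c a b) (t : ℝ) : Measurable (S.ratioSum c t) :=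
  Finset.measurable_sum _ fun i _ =>
    Measurable.ite (S.measurableSet_lt_N i) ((h.meas i).pow_const t) measurable_const

theorem ratioSum_nonneg (h : S.IsRatio c a b) (t : ℝ) (l : S.Λ) : 0 ≤ S.ratioSum c t l := by
  refine Finset.sum_nonneg fun i _ => ?_
  split_ifs
  · exact Real.rpow_nonneg (h.c_pos l i).le t
  · exact le_rfl

theorem ratioSum_le (h : S.IsRatio c a b) {t : ℝ} (ht : 0 ≤ t) (l : S.Λ) :
    S.ratioSum c t l ≤ S.maxN := by
  have : S.ratioSum c t l ≤ ∑ _i : Fin S.maxN, (1 : ℝ) := by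
    refine Finset.sum_le_sum fun i _ => ?_
    split_ifs
    · exact Real.rpow_le_one (h.c_pos l i).le (h.c_lt_one l i).le ht
    · exact zero_le_one
  simpa using this

theorem integrable_ratioSum (h : S.IsRatio c a b) {t : ℝ} (ht : 0 ≤ t) :
    Integrable (S.ratioSum c t) S.μ :=
  Integrable.of_bound (measurable_ratioSum h t).aestronglyMeasurable S.maxN
    (Eventually.of_forall fun l => by
      rw [Real.norm_of_nonneg (ratioSum_nonneg h t l)]; exact ratioSum_le h ht l)

theorem expRange_pos {t : ℝ} (hm : S.meanSum c t ≠ 1) : 0 < S.expRange c t := by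
  have : 0 < |1 - S.meanSum c t| := abs_pos.2 (sub_ne_zero.2 hm.symm)
  unfold expRange
  positivity

/-- To first order the left side is `1 + z * meanSum`, which lies below `1 + z` by `|z| * |1 -
meanSum|` under the sign condition; `expRange` is chosen so that this gap absorbs the quadratic
error. Positive `z` serves the subcritical case and negative `z` the supercritical one. -/
theorem lintegral_exp_ratioSum_le (h : S.IsRatio c a b) {t : ℝ} (ht : 0 ≤ t) {z : ℝ}
    (hz : 0 ≤ z * (1 - S.meanSum c t)) (hz' : |z| ≤ S.expRange c t) :
    ∫⁻ l, ENNReal.ofReal (Real.exp (z * S.ratioSum c t l)) ∂S.μ ≤ ENNReal.ofReal (Real.exp z) := by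
  set M : ℝ := S.maxN + 1
  have hM : 0 < M := by positivity
  have hz1 : |z| * M ≤ 1 := by
    have := hz'.trans (min_le_left _ _)
    rwa [le_div_iff₀ hM] at this
  have hz2 : |z| * M ^ 2 ≤ |1 - S.meanSum c t| := by
    have := hz'.trans (min_le_right _ _)
    rwa [le_div_iff₀ (by positivity)] at this
  have hY : ∀ l, |z * S.ratioSum c t l| ≤ |z| * M := fun l => by
    rw [abs_mul, abs_of_nonneg (ratioSum_nonneg h t l)]
    exact mul_le_mul_of_nonneg_left ((ratioSum_le h ht l).trans (by simp [M])) (abs_nonneg z)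
  have hpt : ∀ l, Real.exp (z * S.ratioSum c t l) ≤
      1 + z * S.ratioSum c t l + |z| * |1 - S.meanSum c t| := fun l => by
    have h1 := Real.abs_exp_sub_one_sub_id_le ((hY l).trans hz1)
    have h2 : (z * S.ratioSum c t l) ^ 2 ≤ (|z| * M) ^ 2 := sq_le_sq' (abs_le.1 (hY l)).1
      (abs_le.1 (hY l)).2
    have h3 : (|z| * M) ^ 2 ≤ |z| * |1 - S.meanSum c t| := by
      calc (|z| * M) ^ 2 = |z| * (|z| * M ^ 2) := by ring
        _ ≤ _ := mul_le_mul_of_nonneg_left hz2 (abs_nonneg z)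
    linarith [(abs_le.1 h1).2]
  have hint : Integrable (fun l => 1 + z * S.ratioSum c t l + |z| * |1 - S.meanSum c t|) S.μ :=
    ((integrable_const _).add ((integrable_ratioSum h ht).const_mul z)).add (integrable_const _)
  calc ∫⁻ l, ENNReal.ofReal (Real.exp (z * S.ratioSum c t l)) ∂S.μ
      ≤ ∫⁻ l, ENNReal.ofReal (1 + z * S.ratioSum c t l + |z| * |1 - S.meanSum c t|) ∂S.μ :=
        lintegral_mono fun l => ENNReal.ofReal_le_ofReal (hpt l)
    _ = ENNReal.ofReal (∫ l, 1 + z * S.ratioSum c t l + |z| * |1 - S.meanSum c t| ∂S.μ) :=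
        (ofReal_integral_eq_lintegral_ofReal hint
          (Eventually.of_forall fun l => (Real.exp_pos _).le.trans (hpt l))).symm
    _ = ENNReal.ofReal (1 + z * S.meanSum c t + |z| * |1 - S.meanSum c t|) := by
        have h1 := (integrable_ratioSum h ht).const_mul z
        rw [integral_add (f := fun l => 1 + z * S.ratioSum c t l) ((integrable_const _).add h1)
          (integrable_const _), integral_add (integrable_const _) h1, integral_const_mul]
        simp [meanSum]
    _ = ENNReal.ofReal (z + 1) := by
        rw [← abs_mul, abs_of_nonneg hz]; ring_nf
    _ ≤ _ := ENNReal.ofReal_le_ofReal (Real.add_one_le_exp z)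

theorem ofReal_exp_sum {ι : Type*} (s : Finset ι) (f : ι → ℝ) :
    ENNReal.ofReal (Real.exp (∑ i ∈ s, f i)) = ∏ i ∈ s, ENNReal.ofReal (Real.exp (f i)) := by
  rw [Real.exp_sum, ENNReal.ofReal_prod_of_nonneg fun _ _ => (Real.exp_pos _).le]

theorem measurable_exp_cutCount (h : S.IsRatio c a b) {D : Set S.Labelling}
    (hD : MeasurableSet D) {ξ : ℝ} (hξ : 0 < ξ) (w : ℝ) :
    Measurable fun τ => ENNReal.ofReal (Real.exp (w * S.cutCount c D ξ τ)) :=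
  (Measurable.of_discrete (f := fun n : ℕ => ENNReal.ofReal (Real.exp (w * n)))).comp
    (measurable_cutCount h hD hξ)

/-- Control of the exponential moments of the number of nodes in a stopping line, from a control
at the root. -/
theorem lintegral_exp_cutCount_le (h : S.IsRatio c a b) {D : Set S.Labelling}
    (hD : MeasurableSet D) {t : ℝ} (ht : 0 ≤ t) {w β : ℝ}
    (hbase : ∀ ξ : ℝ, 1 ≤ ξ → ξ ≤ 1 / a →
      ∫⁻ τ, ENNReal.ofReal (Real.exp (w * S.cutCount c D ξ τ)) ∂S.prob ≤
        ENNReal.ofReal (Real.exp (β * ξ ^ (-t))))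
    (hβ : 0 ≤ β * (1 - S.meanSum c t)) {ξ : ℝ} (hξ : 0 < ξ) (hξa : ξ ≤ 1 / a)
    (hβ' : |β| * ξ ^ (-t) ≤ S.expRange c t) :
    ∫⁻ τ, ENNReal.ofReal (Real.exp (w * S.cutCount c D ξ τ)) ∂S.prob ≤
      ENNReal.ofReal (Real.exp (β * ξ ^ (-t))) := by
  obtain ⟨n, hn⟩ := exists_pow_lt_of_lt_one hξ h.lt_one
  replace hn := hn.le
  induction n generalizing ξ with
  | zero => exact hbase ξ (by simpa using hn) hξa
  | succ n ih =>
    rcases le_or_gt 1 ξ with h1 | h1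
    · exact hbase ξ h1 hξa
    -- By this homogeneity the bounds for the children multiply to `exp (β * ξ ^ (-t) * ratioSum)`,
    -- whose mean is again at most `exp (β * ξ ^ (-t))`. As `ξ < 1` and ratios are at least `a`, the
    -- child thresholds stay below `1 / a`, the range of the base case.
    have hdiv : ∀ l i, (ξ / c l i) ^ (-t) = ξ ^ (-t) * c l i ^ t := fun l i => by
      rw [Real.div_rpow hξ.le (h.c_pos l i).le, Real.rpow_neg (h.c_pos l i).le, div_inv_eq_mul]
    have hξt : 0 ≤ ξ ^ (-t) := Real.rpow_nonneg hξ.le _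
    rw [lintegral_prob_prod S _
      (measurable_exp_cutCount h hD hξ w)
      (fun l i τ => if (i : ℕ) < S.N l then
        ENNReal.ofReal (Real.exp (w * S.cutCount c D (ξ / c l i) τ)) else 1) ?_ ?_]
    · calc ∫⁻ l, ∏ i : Fin S.maxN, ∫⁻ τ, (if (i : ℕ) < S.N l then
              ENNReal.ofReal (Real.exp (w * S.cutCount c D (ξ / c l i) τ)) else 1) ∂S.prob ∂S.μ
          ≤ ∫⁻ l, ENNReal.ofReal (Real.exp (β * ξ ^ (-t) * S.ratioSum c t l)) ∂S.μ := by
            refine lintegral_mono fun l => ?_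
            rw [ratioSum, Finset.mul_sum, ofReal_exp_sum]
            refine Finset.prod_le_prod' fun i _ => ?_
            split_ifs with hi
            · refine (ih (div_pos hξ (h.c_pos _ _)) ?_ ?_ (pow_le_div h hn l i)).trans_eq ?_
              · exact div_le_div₀ zero_le_one h1.le h.pos (h.ge l i)
              · refine le_trans ?_ hβ'
                rw [hdiv]
                refine mul_le_mul_of_nonneg_left ?_ (abs_nonneg β)
                exact mul_le_of_le_one_right hξt
                  (Real.rpow_le_one (h.c_pos l i).le (h.c_lt_one l i).le ht)
              · rw [hdiv, mul_assoc]
            · simp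
        _ ≤ _ := by
            refine lintegral_exp_ratioSum_le h ht ?_ ?_
            · rw [mul_right_comm]; exact mul_nonneg hβ hξt
            · rwa [abs_mul, abs_of_nonneg hξt]
    · intro l i
      split_ifs
      · exact measurable_exp_cutCount h hD (div_pos hξ (h.c_pos l i)) w
      · exact measurable_const
    · intro τ
      rw [cutCount_of_lt_one h D hξ h1]
      push_cast
      rw [Finset.mul_sum, ofReal_exp_sum]
      refine Finset.prod_congr rfl fun i _ => ?_
      split_ifs <;> simp

end RIFS

/-! ### Upper bound for stopping lines, uniformly over subtrees -/

namespace RIFS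

variable {d k : ℕ} {S : RIFS d k} {c : S.Λ → Fin S.maxN → ℝ} {a b : ℝ}

theorem IsRatio.b_pos (h : S.IsRatio c a b) : 0 < b := h.pos.trans_le h.ab

/-- The coefficient `β = κ * ξ ^ t` makes the exponent at scale `ξ` exactly `κ`, the largest one
allowed. The factor `a ^ t` pays for thresholds that overshoot `1`, up to `1 / a`, where the count
is `1`. -/
theorem lintegral_exp_cutCount_univ_le (h : S.IsRatio c a b) {t : ℝ} (ht : 0 ≤ t)
    (hm : S.meanSum c t < 1) {ξ : ℝ} (hξ : 0 < ξ) (hξ1 : ξ ≤ 1) :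
    ∫⁻ τ, ENNReal.ofReal (Real.exp (S.expRange c t * a ^ t * ξ ^ t * S.cutCount c univ ξ τ))
      ∂S.prob ≤ ENNReal.ofReal (Real.exp (S.expRange c t)) := by
  have hκ := expRange_pos hm.ne
  set κ := S.expRange c t
  have hξt : 0 < ξ ^ t := Real.rpow_pos_of_pos hξ t
  have hself : κ * ξ ^ t * ξ ^ (-t) = κ := by
    rw [Real.rpow_neg hξ.le, mul_assoc, mul_inv_cancel₀ hξt.ne', mul_one]
  have := lintegral_exp_cutCount_le h (D := univ) MeasurableSet.univ ht
    (w := κ * a ^ t * ξ ^ t) (β := κ * ξ ^ t) ?_ (mul_nonneg (by positivity) (by linarith)) hξ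
    (hξ1.trans ((one_le_div h.pos).2 (h.ab.trans h.lt_one.le)))
    (by rw [abs_of_pos (by positivity), hself])
  · rwa [hself] at this
  · intro ζ hζ hζa
    have hζ0 : 0 < ζ := one_pos.trans_le hζ
    have hle : a ^ t ≤ ζ ^ (-t) := by
      rw [Real.rpow_neg hζ0.le, ← Real.inv_rpow hζ0.le]
      refine Real.rpow_le_rpow h.pos.le ?_ ht
      rwa [le_inv_comm₀ h.pos hζ0, ← one_div]
    have : ∀ τ, S.cutCount c univ ζ τ = 1 := fun τ => cutCount_of_one_le_mem hζ (mem_univ τ)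
    simp only [this, Nat.cast_one, mul_one, lintegral_const, measure_univ]
    refine ENNReal.ofReal_le_ofReal (Real.exp_le_exp.2 ?_)
    calc κ * a ^ t * ξ ^ t = κ * ξ ^ t * a ^ t := by ring
      _ ≤ _ := mul_le_mul_of_nonneg_left hle (by positivity)

theorem prob_le_cutCount (h : S.IsRatio c a b) {t : ℝ} (ht : 0 ≤ t)
    (hm : S.meanSum c t < 1) {ξ : ℝ} (hξ : 0 < ξ) (hξ1 : ξ ≤ 1) (y : ℝ) :
    S.prob {τ | y ≤ ξ ^ t * S.cutCount c univ ξ τ} ≤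
      ENNReal.ofReal (Real.exp (S.expRange c t * (1 - a ^ t * y))) := by
  have hκ := expRange_pos hm.ne
  set κ := S.expRange c t
  have hat : 0 < a ^ t := Real.rpow_pos_of_pos h.pos t
  have h1 := mul_meas_ge_le_lintegral₀ (μ := S.prob)
    (measurable_exp_cutCount h (D := univ) MeasurableSet.univ hξ (κ * a ^ t * ξ ^ t)).aemeasurable
    (ENNReal.ofReal (Real.exp (κ * a ^ t * y)))
  have h2 := h1.trans (lintegral_exp_cutCount_univ_le h ht hm hξ hξ1)
  have h3 : S.prob {τ | y ≤ ξ ^ t * S.cutCount c univ ξ τ} ≤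
      S.prob {τ | ENNReal.ofReal (Real.exp (κ * a ^ t * y)) ≤
        ENNReal.ofReal (Real.exp (κ * a ^ t * ξ ^ t * S.cutCount c univ ξ τ))} := by
    refine measure_mono fun τ (hτ : y ≤ _) => ENNReal.ofReal_le_ofReal (Real.exp_le_exp.2 ?_)
    rw [mul_assoc _ (ξ ^ t)]
    exact mul_le_mul_of_nonneg_left hτ (by positivity)
  refine h3.trans ?_
  have h4 : Real.exp (κ * (1 - a ^ t * y)) = Real.exp κ / Real.exp (κ * a ^ t * y) := by
    rw [← Real.exp_sub]; ring_nf
  rw [h4, ENNReal.ofReal_div_of_pos (Real.exp_pos _), ENNReal.le_div_iff_mul_le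
    (Or.inl (by simp [Real.exp_pos])) (Or.inl ENNReal.ofReal_ne_top), mul_comm]
  exact h2

/-- Union bound, since every subtree has the law of the whole tree; `(maxN + 1) ^ n` is a crude
bound for the number of nodes up to level `n`. -/
theorem prob_exists_sub_mem_le (S : RIFS d k) {A : Set S.Labelling} (hA : MeasurableSet A)
    (n : ℕ) :
    S.prob {τ | ∃ v : List (Fin S.maxN), v.length ≤ n ∧ S.sub τ v ∈ A} ≤
      ((S.maxN : ℝ≥0∞) + 1) ^ n * S.prob A := by
  have hmeas : ∀ n, MeasurableSet {τ | ∃ v : List (Fin S.maxN), v.length ≤ n ∧ S.sub τ v ∈ A} := by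
    intro n
    have : {τ | ∃ v : List (Fin S.maxN), v.length ≤ n ∧ S.sub τ v ∈ A} =
        ⋃ (v : List (Fin S.maxN)) (_ : v.length ≤ n), {τ | S.sub τ v ∈ A} := by
      ext; simp
    rw [this]
    exact MeasurableSet.iUnion fun v => MeasurableSet.iUnion fun _ => S.measurable_sub v hA
  induction n with
  | zero =>
    simp only [Nat.le_zero, List.length_eq_zero_iff, pow_zero, one_mul]
    exact measure_mono fun τ hτ => by
      obtain ⟨v, rfl, hv⟩ := hτ; exact hv
  | succ n ih =>
    set E := {τ | ∃ v : List (Fin S.maxN), v.length ≤ n ∧ S.sub τ v ∈ A}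
    have hsub : {τ | ∃ v : List (Fin S.maxN), v.length ≤ n + 1 ∧ S.sub τ v ∈ A} ⊆
        A ∪ ⋃ i : Fin S.maxN, {τ | S.sub τ [i] ∈ E} := by
      rintro τ ⟨v, hv, hA⟩
      cases v with
      | nil => exact Or.inl hA
      | cons i v => exact Or.inr (mem_iUnion.2 ⟨i, v, by simpa using hv, hA⟩)
    calc _ ≤ S.prob A + ∑ i : Fin S.maxN, S.prob {τ | S.sub τ [i] ∈ E} :=
          (measure_mono hsub).trans ((measure_union_le _ _).trans
            (add_le_add le_rfl (measure_iUnion_fintype_le _ _)))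
      _ = S.prob A + S.maxN * S.prob E := by
          rw [Finset.sum_congr rfl fun i _ => S.prob_sub_mem [i] (hmeas n)]
          simp [E]
      _ ≤ ((S.maxN : ℝ≥0∞) + 1) ^ n * S.prob A + S.maxN * (((S.maxN : ℝ≥0∞) + 1) ^ n * S.prob A) :=
          add_le_add (le_mul_of_one_le_left' (one_le_pow₀ (by simp))) (by gcongr)
      _ = _ := by ring

theorem ae_eventually_cutCount_lt (h : S.IsRatio c a b) {t : ℝ} (ht : 0 ≤ t)
    (hm : S.meanSum c t < 1) (K : ℕ) :
    ∃ L : ℝ, ∀ᵐ τ ∂S.prob, ∀ᶠ n : ℕ in atTop, ∀ v : List (Fin S.maxN), v.length ≤ K * n →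
      (b ^ n) ^ t * S.cutCount c univ (b ^ n) (S.sub τ v) < L * (n + 1) := by
  have hκ := expRange_pos hm.ne
  set κ := S.expRange c t
  have hat : 0 < a ^ t := Real.rpow_pos_of_pos h.pos t
  -- With this `Q` and `L`, the tail at `L * (n + 1)` is `exp κ * Q ^ (-(n + 1))`. It outweighs the
  -- `(maxN + 1) ^ (K * n)` of the union bound and leaves the summable `2 ^ (-n)`.
  set Q : ℝ := 2 * ((S.maxN : ℝ) + 1) ^ K
  have hQ : 0 < Q := by positivity
  set L := Real.log Q / (κ * a ^ t)
  refine ⟨L, ?_⟩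
  set A : ℕ → Set S.Labelling := fun n =>
    {τ | L * (n + 1) ≤ (b ^ n) ^ t * S.cutCount c univ (b ^ n) τ}
  have hA : ∀ n, MeasurableSet (A n) := fun n =>
    measurableSet_le measurable_const (measurable_const.mul (Measurable.of_discrete.comp
      (measurable_cutCount h (D := univ) MeasurableSet.univ (pow_pos h.b_pos n))))
  have hPA : ∀ n, S.prob (A n) ≤ ENNReal.ofReal (Real.exp κ * (Q ^ (n + 1))⁻¹) := fun n => by
    refine (prob_le_cutCount h ht hm (pow_pos h.b_pos n)
      (pow_le_one₀ h.b_pos.le h.lt_one.le) _).trans_eq ?_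
    congr 1
    have : κ * (1 - a ^ t * (L * (n + 1))) = κ - (n + 1 : ℕ) * Real.log Q := by
      simp only [L]; field_simp; push_cast; ring
    rw [this, Real.exp_sub, Real.exp_nat_mul, Real.exp_log hQ, div_eq_mul_inv]
  have hle : ∀ n, S.prob {τ | ∃ v : List (Fin S.maxN), v.length ≤ K * n ∧ S.sub τ v ∈ A n} ≤
      ENNReal.ofReal (Real.exp κ * (1 / 2) ^ n) := fun n => by
    refine (S.prob_exists_sub_mem_le (hA n) _).trans ?_
    have h1 : ((S.maxN : ℝ≥0∞) + 1) ^ (K * n) =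
        ENNReal.ofReal (((S.maxN : ℝ) + 1) ^ (K * n)) := by
      rw [ENNReal.ofReal_pow (by positivity), ENNReal.ofReal_add (by positivity) zero_le_one]
      simp
    rw [h1]
    refine (mul_le_mul_right (hPA n) _).trans ?_
    rw [← ENNReal.ofReal_mul (by positivity)]
    refine ENNReal.ofReal_le_ofReal ?_
    have h2 : Q ^ n = 2 ^ n * ((S.maxN : ℝ) + 1) ^ (K * n) := by
      simp only [Q]; rw [mul_pow, ← pow_mul]
    have h3 : (1 : ℝ) ≤ Q := by
      have : (1 : ℝ) ≤ ((S.maxN : ℝ) + 1) ^ K := one_le_pow₀ (by simp)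
      simp only [Q]; linarith
    have h4 : (Q ^ (n + 1))⁻¹ ≤ (Q ^ n)⁻¹ :=
      inv_anti₀ (pow_pos hQ n) (pow_le_pow_right₀ h3 (Nat.le_succ n))
    calc ((S.maxN : ℝ) + 1) ^ (K * n) * (Real.exp κ * (Q ^ (n + 1))⁻¹)
        ≤ ((S.maxN : ℝ) + 1) ^ (K * n) * (Real.exp κ * (Q ^ n)⁻¹) := by gcongr
      _ = _ := by rw [h2, one_div, inv_pow]; field_simp
  have hsum : ∑' n, S.prob {τ | ∃ v : List (Fin S.maxN), v.length ≤ K * n ∧ S.sub τ v ∈ A n} ≠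
      ∞ := by
    refine ne_top_of_le_ne_top ?_ (ENNReal.tsum_le_tsum hle)
    exact ((summable_geometric_of_lt_one (by norm_num) (by norm_num)).mul_left _).tsum_ofReal_ne_top
  filter_upwards [ae_eventually_notMem hsum] with τ hτ
  filter_upwards [hτ] with n hn v hv
  by_contra hcon
  exact hn ⟨v, hv, not_lt.1 hcon⟩

/-- Almost surely, all subtrees at nodes of level at most `K * n` have stopping lines at `b ^ n`
of size at most `b ^ (-n * t)`, for large `n`. -/
theorem ae_eventually_cutCount_le (h : S.IsRatio c a b) {s : ℝ} (hs : 0 ≤ s)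
    (hm : ∀ t, s < t → S.meanSum c t < 1) :
    ∀ᵐ τ ∂S.prob, ∀ t, s < t → ∀ K : ℕ, ∀ᶠ n : ℕ in atTop, ∀ v : List (Fin S.maxN),
      v.length ≤ K * n → (S.cutCount c univ (b ^ n) (S.sub τ v) : ℝ) ≤ (b ^ n) ^ (-t) := by
  have hj : ∀ j : ℕ, s < s + 1 / ((j : ℝ) + 1) := fun j => by
    have : (0 : ℝ) < 1 / ((j : ℝ) + 1) := by positivity
    linarith
  -- Countably many exponents decreasing to `s` suffice for a common null set. For `t` above such an
  -- exponent `u`, the linear factor `L * (n + 1)` is absorbed by `b ^ (n * (t - u))`.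
  have key : ∀ᵐ τ ∂S.prob, ∀ j K : ℕ, ∃ L : ℝ, ∀ᶠ n : ℕ in atTop, ∀ v : List (Fin S.maxN),
      v.length ≤ K * n → (b ^ n) ^ (s + 1 / ((j : ℝ) + 1)) *
        S.cutCount c univ (b ^ n) (S.sub τ v) < L * (n + 1) := by
    refine ae_all_iff.2 fun j => ae_all_iff.2 fun K => ?_
    obtain ⟨L, hL⟩ := ae_eventually_cutCount_lt h (hs.trans (hj j).le) (hm _ (hj j)) K
    filter_upwards [hL] with τ hτ using ⟨L, hτ⟩
  filter_upwards [key] with τ hτ t hst K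
  obtain ⟨j, hjt⟩ := exists_nat_one_div_lt (sub_pos.2 hst)
  obtain ⟨L, hL⟩ := hτ j K
  set u := s + 1 / ((j : ℝ) + 1)
  have hut : 0 < t - u := by simp only [u]; linarith
  set q := b ^ (t - u)
  have hq0 : 0 ≤ q := Real.rpow_nonneg h.b_pos.le _
  have hq1 : q < 1 := Real.rpow_lt_one h.b_pos.le h.lt_one hut
  have hlim : Tendsto (fun n : ℕ => L * ((n : ℝ) * q ^ n + q ^ n)) atTop (𝓝 0) := by
    simpa using ((tendsto_self_mul_const_pow_of_lt_one hq0 hq1).add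
      (tendsto_pow_atTop_nhds_zero_of_lt_one hq0 hq1)).const_mul L
  filter_upwards [hL, hlim.eventually_le_const one_pos] with n hn hn1 v hv
  have hb : 0 < b ^ n := pow_pos h.b_pos n
  have h1 := (hn v hv).le
  have h2 : (b ^ n) ^ t = (b ^ n) ^ u * q ^ n := by
    have : q ^ n = (b ^ n) ^ (t - u) := by
      simp only [q]
      rw [← Real.rpow_natCast, ← Real.rpow_natCast, ← Real.rpow_mul h.b_pos.le,
        ← Real.rpow_mul h.b_pos.le, mul_comm]
    rw [this, ← Real.rpow_add hb]; ring_nf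
  rw [Real.rpow_neg hb.le, ← one_div, le_div_iff₀ (Real.rpow_pos_of_pos hb t), h2]
  have hqn : 0 ≤ q ^ n := pow_nonneg hq0 n
  nlinarith [mul_le_mul_of_nonneg_right h1 hqn]

end RIFS

namespace RIFS

variable {d k : ℕ} {S : RIFS d k} {c : S.Λ → Fin S.maxN → ℝ} {a b : ℝ}

/-! ### Survival -/

/-- The labellings whose tree of codings is infinite. -/
def alive (S : RIFS d k) : Set S.Labelling :=
  {τ | ∀ n : ℕ, ∃ v : List (Fin S.maxN), n ≤ v.length ∧ S.IsCoding τ v}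

theorem measurableSet_alive (S : RIFS d k) : MeasurableSet S.alive := by
  have : S.alive = ⋂ n : ℕ, ⋃ (v : List (Fin S.maxN)) (_ : n ≤ v.length), {τ | S.IsCoding τ v} := by
    ext; simp [alive]
  rw [this]
  exact MeasurableSet.iInter fun n => MeasurableSet.iUnion fun v => MeasurableSet.iUnion fun _ =>
    measurableSet_isCoding v

theorem mem_alive_of_sub {τ : S.Labelling} {v : List (Fin S.maxN)} (hv : S.IsCoding τ v)
    (h : S.sub τ v ∈ S.alive) : τ ∈ S.alive := fun n => by
  obtain ⟨w, hn, hw⟩ := h n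
  exact ⟨v ++ w, by simp; omega, (isCoding_append _ _ _).2 ⟨hv, hw⟩⟩

/-- A König step: if all of the finitely many children had finite trees, the largest of their
heights would bound the whole tree. -/
theorem exists_shift_mem_alive {τ : S.Labelling} (h : τ ∈ S.alive) :
    ∃ i : Fin S.maxN, (i : ℕ) < S.N (τ []) ∧ S.shift τ i ∈ S.alive := by
  by_contra! hcon
  have : ∀ i : Fin S.maxN, ∃ n : ℕ, (i : ℕ) < S.N (τ []) → ∀ v : List (Fin S.maxN), n ≤ v.length →
      ¬ S.IsCoding (S.shift τ i) v := fun i => by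
    by_cases hi : (i : ℕ) < S.N (τ [])
    · have := hcon i hi
      simp only [alive, mem_ofPred_eq] at this
      push Not at this
      obtain ⟨n, hn⟩ := this
      exact ⟨n, fun _ => hn⟩
    · exact ⟨0, fun h => absurd h hi⟩
  choose f hf using this
  obtain ⟨v, hv, hc⟩ := h (Finset.univ.sup f + 1)
  cases v with
  | nil => simp at hv
  | cons i v =>
    refine hf i hc.1 v ?_ hc.2
    have := Finset.le_sup (f := f) (Finset.mem_univ i)
    simp only [List.length_cons] at hv
    omega

theorem cutSet_alive_nonempty (h : S.IsRatio c a b) {ξ : ℝ} (hξ : 0 < ξ)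
    {τ : S.Labelling} (hτ : τ ∈ S.alive) : (S.cutSet c S.alive ξ τ).Nonempty := by
  obtain ⟨n, hn⟩ := exists_pow_lt_of_lt_one hξ h.lt_one
  replace hn := hn.le
  induction n generalizing ξ τ with
  | zero => exact ⟨[], by simpa [InCut] using hn, hτ⟩
  | succ n ih =>
    rcases le_or_gt 1 ξ with h1 | h1
    · exact ⟨[], h1, hτ⟩
    · obtain ⟨i, hi, ha⟩ := exists_shift_mem_alive hτ
      obtain ⟨v, hv, hva⟩ := ih (div_pos hξ (h.c_pos _ _)) ha (pow_le_div h hn (τ []) i)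
      exact ⟨i :: v, ⟨h1, hi, hv⟩, hva⟩

theorem cutCount_mono (h : S.IsRatio c a b) {D E : Set S.Labelling} (hDE : D ⊆ E) {ξ : ℝ}
    (hξ : 0 < ξ) (τ : S.Labelling) : S.cutCount c D ξ τ ≤ S.cutCount c E ξ τ :=
  Set.ncard_le_ncard (fun _ hv => ⟨hv.1, hDE hv.2⟩) (cutSet_finite h E hξ τ)

/-- For `ξ ≤ η` the line at `ξ` refines the line at `η`: the parts of it below distinct nodes of the
coarser line are disjoint, so their counts add up. -/
theorem mul_cutCount_le (h : S.IsRatio c a b) {D E : Set S.Labelling} {ξ η X : ℝ} (hξ : 0 < ξ)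
    (hη : ξ ≤ η) {τ : S.Labelling}
    (hX : ∀ v ∈ S.cutSet c E η τ, X ≤ S.cutCount c D (ξ / S.cratio c τ v) (S.sub τ v)) :
    X * S.cutCount c E η τ ≤ S.cutCount c D ξ τ := by
  obtain ⟨n, hn⟩ := exists_pow_lt_of_lt_one (hξ.trans_le hη) h.lt_one
  replace hn := hn.le
  induction n generalizing ξ η τ with
  | zero =>
    have h1 : 1 ≤ η := by simpa using hn
    by_cases hτ : τ ∈ E
    · rw [cutCount_of_one_le_mem h1 hτ]
      simpa [cratio] using hX [] ⟨h1, hτ⟩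
    · rw [cutCount_of_one_le_notMem h1 hτ]
      simp
  | succ n ih =>
    rcases le_or_gt 1 η with h1 | h1
    · by_cases hτ : τ ∈ E
      · rw [cutCount_of_one_le_mem h1 hτ]
        simpa [cratio] using hX [] ⟨h1, hτ⟩
      · rw [cutCount_of_one_le_notMem h1 hτ]
        simp
    · rw [cutCount_of_lt_one h E (hξ.trans_le hη) h1,
        cutCount_of_lt_one h D hξ (hη.trans_lt h1)]
      push_cast
      rw [Finset.mul_sum]
      refine Finset.sum_le_sum fun i _ => ?_
      have hc := h.c_pos (τ []) i
      split_ifs with hi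
      · refine ih (div_pos hξ hc) (div_le_div_of_nonneg_right hη hc.le) ?_ (pow_le_div h hn _ i)
        intro v hv
        rw [div_div]
        exact hX (i :: v) ⟨⟨h1, hi, hv.1⟩, hv.2⟩
      · simp

/-! ### Trees with many nodes in each stopping line -/

/-- Labellings for which, `n` times in a row, each chosen node has at least `p` chosen successors
in its stopping line at `η`. -/
def richSet (S : RIFS d k) (c : S.Λ → Fin S.maxN → ℝ) (η p : ℝ) : ℕ → Set S.Labelling
  | 0 => univ
  | n + 1 => {τ | p ≤ S.cutCount c (S.richSet c η p n) η τ}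

theorem measurableSet_richSet (h : S.IsRatio c a b) {η : ℝ} (hη : 0 < η) (p : ℝ) (n : ℕ) :
    MeasurableSet (S.richSet c η p n) := by
  induction n with
  | zero => exact MeasurableSet.univ
  | succ n ih =>
    exact measurableSet_le measurable_const
      (Measurable.of_discrete.comp (measurable_cutCount h ih hη))

theorem richSet_antitone (h : S.IsRatio c a b) {η : ℝ} (hη : 0 < η) (p : ℝ) :
    Antitone (S.richSet c η p) := by
  refine antitone_nat_of_succ_le fun n => ?_
  induction n with
  | zero => exact subset_univ _
  | succ n ih =>
    intro τ hτ
    exact le_trans (α := ℝ) hτ (Nat.cast_le.2 (cutCount_mono h ih hη τ))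

theorem half_le_one_sub_exp_neg {u : ℝ} (h0 : 0 ≤ u) (h1 : u ≤ 1) :
    u / 2 ≤ 1 - Real.exp (-u) := by
  have h2 : Real.exp (-u) ≤ 1 / (1 + u) := by
    rw [Real.exp_neg, ← one_div]
    exact one_div_le_one_div_of_le (by linarith) (by linarith [Real.add_one_le_exp u])
  have h3 : 1 / (1 + u) ≤ 1 - u / 2 := by
    rw [div_le_iff₀ (by linarith)]; nlinarith
  linarith

/-- At thresholds `ξ ≥ 1` the count is the indicator of `D`, so the moment is `1 - P(D) * (1 - exp
(-u))`, at most `exp (-x * u / 2)`. The moment recursion with `β = -x * u / 2` carries this down to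
`η`. -/
theorem lintegral_exp_neg_cutCount_le (h : S.IsRatio c a b) {D : Set S.Labelling}
    (hD : MeasurableSet D) {x : ℝ} (hx0 : 0 ≤ x) (hx : x ≤ S.prob.real D) {t : ℝ} (ht : 0 ≤ t)
    (hm : 1 < S.meanSum c t) {η : ℝ} (hη : 0 < η) (hη1 : η ≤ 1) {u : ℝ} (hu0 : 0 ≤ u) (hu1 : u ≤ 1)
    (huη : x / 2 * u * η ^ (-t) ≤ S.expRange c t) :
    ∫⁻ τ, ENNReal.ofReal (Real.exp (-u * S.cutCount c D η τ)) ∂S.prob ≤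
      ENNReal.ofReal (Real.exp (-(x / 2 * u) * η ^ (-t))) := by
  have hxu : 0 ≤ x / 2 * u := by positivity
  refine lintegral_exp_cutCount_le h hD ht ?_ ?_ hη
    (hη1.trans ((one_le_div h.pos).2 (h.ab.trans h.lt_one.le))) (by rwa [abs_neg, abs_of_nonneg hxu])
  · intro ξ hξ _
    classical
    have hf : ∀ τ, Real.exp (-u * S.cutCount c D ξ τ) =
        1 - D.indicator (fun _ => 1 - Real.exp (-u)) τ := fun τ => by
      by_cases hτ : τ ∈ D
      · rw [cutCount_of_one_le_mem hξ hτ, indicator_of_mem hτ]; simp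
      · rw [cutCount_of_one_le_notMem hξ hτ, indicator_of_notMem hτ]; simp
    have hint : Integrable (fun τ => 1 - D.indicator (fun _ => 1 - Real.exp (-u)) τ) S.prob :=
      (integrable_const _).sub ((integrable_const _).indicator hD)
    simp only [hf]
    rw [← ofReal_integral_eq_lintegral_ofReal hint
      (Eventually.of_forall fun τ => by simp only [Pi.zero_apply, ← hf]; exact (Real.exp_pos _).le)]
    refine ENNReal.ofReal_le_ofReal ?_
    rw [integral_sub (integrable_const _) ((integrable_const _).indicator hD),
      integral_indicator_const _ hD]
    simp only [integral_const, probReal_univ, smul_eq_mul, mul_one]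
    have h1 := half_le_one_sub_exp_neg hu0 hu1
    have h2 : x * (u / 2) ≤ S.prob.real D * (1 - Real.exp (-u)) :=
      mul_le_mul hx h1 (by positivity) measureReal_nonneg
    have h3 : ξ ^ (-t) ≤ 1 := Real.rpow_le_one_of_one_le_of_nonpos hξ (by linarith)
    have h4 : -(x / 2 * u) ≤ -(x / 2 * u) * ξ ^ (-t) := by nlinarith
    have h5 := Real.add_one_le_exp (-(x / 2 * u))
    have h6 := Real.exp_le_exp.2 h4
    linarith
  · have : 0 ≤ x / 2 * u * (S.meanSum c t - 1) := mul_nonneg hxu (by linarith)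
    linarith

/-- A bound that reproduces itself from depth `n` to `n + 1`. With `u` chosen so that the moment is
at most `exp (-κ)` and `u * p = κ / 2`, Markov bounds the failure probability by `exp (-κ / 2)`,
which is `1 - x`. Thus `x` does not deteriorate with the depth. -/
theorem le_prob_richSet (h : S.IsRatio c a b) {t : ℝ} (ht : 0 ≤ t) (hm : 1 < S.meanSum c t)
    {x : ℝ} (hx : x = 1 - Real.exp (-(S.expRange c t / 2))) {η : ℝ} (hη : 0 < η) (hη1 : η ≤ 1)
    (hηx : S.expRange c t ≤ x / 2 * η ^ (-t)) (n : ℕ) :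
    x ≤ S.prob.real (S.richSet c η (x / 4 * η ^ (-t)) n) := by
  have hκ := expRange_pos hm.ne'
  set κ := S.expRange c t
  have hx0 : 0 < x := by
    have : Real.exp (-(κ / 2)) < 1 := by
      rw [← Real.exp_zero]; exact Real.exp_lt_exp.2 (by linarith)
    linarith
  have hx1 : x ≤ 1 := by linarith [Real.exp_pos (-(κ / 2))]
  have hηt : 0 < η ^ (-t) := Real.rpow_pos_of_pos hη _
  set p := x / 4 * η ^ (-t)
  induction n with
  | zero => simpa [richSet] using hx1
  | succ n ih =>
    set D := S.richSet c η p n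
    have hD : MeasurableSet D := measurableSet_richSet h hη p n
    set u := κ / (x / 2 * η ^ (-t))
    have hden : 0 < x / 2 * η ^ (-t) := by positivity
    have hu0 : 0 < u := div_pos hκ hden
    have hu1 : u ≤ 1 := (div_le_one hden).2 hηx
    have hu : x / 2 * u * η ^ (-t) = κ := by simp only [u]; field_simp
    have hup : u * p = κ / 2 := by simp only [p]; linarith
    have h1 := lintegral_exp_neg_cutCount_le h hD hx0.le ih ht hm hη hη1 hu0.le hu1 hu.le
    rw [neg_mul, hu] at h1
    have h2 := (mul_meas_ge_le_lintegral₀ (μ := S.prob)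
      (measurable_exp_cutCount h hD hη (-u)).aemeasurable
      (ENNReal.ofReal (Real.exp (-(κ / 2))))).trans h1
    have hG : MeasurableSet (S.richSet c η p (n + 1)) := measurableSet_richSet h hη p (n + 1)
    have h3 : S.prob (S.richSet c η p (n + 1))ᶜ ≤ S.prob {τ | ENNReal.ofReal (Real.exp (-(κ / 2))) ≤
        ENNReal.ofReal (Real.exp (-u * S.cutCount c D η τ))} := by
      refine measure_mono fun τ hτ => ENNReal.ofReal_le_ofReal (Real.exp_le_exp.2 ?_)
      have hτ' : (S.cutCount c D η τ : ℝ) < p := not_le.1 hτ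
      nlinarith
    have h4 : ENNReal.ofReal (Real.exp (-(κ / 2))) * S.prob (S.richSet c η p (n + 1))ᶜ ≤
        ENNReal.ofReal (Real.exp (-κ)) := (mul_le_mul_right h3 _).trans h2
    have h5 : Real.exp (-(κ / 2)) * S.prob.real (S.richSet c η p (n + 1))ᶜ ≤ Real.exp (-κ) := by
      have := ENNReal.toReal_mono ENNReal.ofReal_ne_top h4
      rwa [ENNReal.toReal_mul, ENNReal.toReal_ofReal (Real.exp_pos _).le,
        ENNReal.toReal_ofReal (Real.exp_pos _).le] at this
    have h6 : Real.exp (-κ) = Real.exp (-(κ / 2)) * Real.exp (-(κ / 2)) := by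
      rw [← Real.exp_add]; ring_nf
    rw [h6] at h5
    have h7 := le_of_mul_le_mul_left h5 (Real.exp_pos _)
    rw [probReal_compl_eq_one_sub hG] at h7
    linarith

/-- The line is finite and the sets decrease, so one depth `n` decides, for all its nodes at once,
whether the subtree is rich at every depth. -/
theorem le_cutCount_iInter_richSet (h : S.IsRatio c a b) {η : ℝ} (hη : 0 < η) {p : ℝ}
    {τ : S.Labelling} (hτ : τ ∈ ⋂ n, S.richSet c η p n) :
    p ≤ S.cutCount c (⋂ n, S.richSet c η p n) η τ := by
  have hfin := cutSet_finite h univ hη τ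
  have : ∀ᶠ n in atTop, ∀ v ∈ S.cutSet c univ η τ,
      S.sub τ v ∈ S.richSet c η p n → S.sub τ v ∈ ⋂ n, S.richSet c η p n := by
    refine (eventually_all_finite hfin).2 fun v _ => ?_
    by_cases hv : S.sub τ v ∈ ⋂ n, S.richSet c η p n
    · exact Eventually.of_forall fun _ _ => hv
    · simp only [mem_iInter, not_forall] at hv
      obtain ⟨m, hm⟩ := hv
      filter_upwards [eventually_ge_atTop m] with n hn hvn
      exact absurd (richSet_antitone h hη p hn hvn) hm
  obtain ⟨n, hn⟩ := this.exists
  have h1 : p ≤ S.cutCount c (S.richSet c η p n) η τ := mem_iInter.1 hτ (n + 1)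
  refine h1.trans (Nat.cast_le.2 (Set.ncard_le_ncard ?_ (cutSet_finite h _ hη τ)))
  exact fun v hv => ⟨hv.1, hn v ⟨hv.1, mem_univ _⟩ hv.2⟩

theorem iInter_richSet_subset_alive (h : S.IsRatio c a b) {η : ℝ} (hη : 0 < η) (hη1 : η < 1) {p : ℝ}
    (hp : 0 < p) : (⋂ n, S.richSet c η p n) ⊆ S.alive := by
  intro τ hτ n
  induction n generalizing τ with
  | zero => exact ⟨[], le_rfl, trivial⟩
  | succ n ih =>
    have h1 : 0 < S.cutCount c (⋂ n, S.richSet c η p n) η τ :=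
      Nat.cast_pos.1 (hp.trans_le (le_cutCount_iInter_richSet h hη hτ))
    obtain ⟨v, hv⟩ := (Set.ncard_pos (cutSet_finite h _ hη τ)).1 h1
    obtain ⟨w, hw, hwc⟩ := ih hv.2
    refine ⟨v ++ w, ?_, (isCoding_append _ _ _).2 ⟨hv.1.isCoding, hwc⟩⟩
    cases v with
    | nil => exact absurd hv.1 hη1.not_ge
    | cons i v => simp only [List.cons_append, List.length_cons, List.length_append]; omega

/-- Each generation of rich nodes multiplies the count by `p` and shrinks the ratio by no more than
`a * η`. After `n` generations every rich node, being alive, contributes at least one surviving node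
to the line at `ξ`. -/
theorem pow_le_cutCount_alive (h : S.IsRatio c a b) {η : ℝ} (hη : 0 < η) (hη1 : η < 1) {p : ℝ}
    (hp : 0 < p) {n : ℕ} {ξ : ℝ} (hξ : 0 < ξ) (hξn : ξ ≤ (a * η) ^ n) {τ : S.Labelling}
    (hτ : τ ∈ ⋂ n, S.richSet c η p n) : p ^ n ≤ S.cutCount c S.alive ξ τ := by
  have haη : a * η ≤ η := mul_le_of_le_one_left hη.le (h.ab.trans h.lt_one.le)
  have haη0 : 0 < a * η := mul_pos h.pos hη
  induction n generalizing ξ τ with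
  | zero =>
    rw [pow_zero, Nat.one_le_cast]
    refine (Set.ncard_pos (cutSet_finite h _ hξ τ)).2 ?_
    exact cutSet_alive_nonempty h hξ (iInter_richSet_subset_alive h hη hη1 hp hτ)
  | succ n ih =>
    have h1 := le_cutCount_iInter_richSet h hη hτ
    have hξη : ξ ≤ η := by
      refine hξn.trans (le_trans ?_ haη)
      rw [pow_succ]
      exact mul_le_of_le_one_left haη0.le (pow_le_one₀ haη0.le (haη.trans hη1.le))
    refine le_trans ?_ (mul_cutCount_le h hξ hξη (E := ⋂ n, S.richSet c η p n) (X := p ^ n) ?_)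
    · rw [pow_succ]; exact mul_le_mul_of_nonneg_left h1 (pow_nonneg hp.le n)
    · intro v hv
      have hb := hv.1.cratio_bounds h hη hη1.le
      have hr := cratio_pos h τ v
      refine ih (div_pos hξ hr) ?_ hv.2
      rw [div_le_iff₀ hr]
      refine hξn.trans ?_
      rw [pow_succ]
      exact mul_le_mul_of_nonneg_left hb.1.le (pow_nonneg haη0.le n)

end RIFS

namespace RIFS

variable {d k : ℕ} {S : RIFS d k} {c : S.Λ → Fin S.maxN → ℝ} {a b : ℝ}

/-! ### The generating function of the number of maps -/

/-- The generating function of the number of maps. -/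
noncomputable def genFun (S : RIFS d k) (x : ℝ) : ℝ := ∫ l, x ^ S.N l ∂S.μ

theorem integrable_comp_N (S : RIFS d k) (g : ℕ → ℝ) : Integrable (fun l => g (S.N l)) S.μ := by
  refine Integrable.of_bound
    ((Measurable.of_discrete (f := g)).comp S.measurable_N).aestronglyMeasurable
    (∑ n ∈ Finset.range (S.maxN + 1), ‖g n‖) (Eventually.of_forall fun l => ?_)
  exact Finset.single_le_sum (f := fun n => ‖g n‖) (fun _ _ => norm_nonneg _)
    (Finset.mem_range.2 (Nat.lt_succ_of_le (S.N_le l)))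

theorem card_filter_lt {M n : ℕ} (h : n ≤ M) :
    (Finset.univ.filter fun i : Fin M => (i : ℕ) < n).card = n := by
  rw [Fin.card_filter_val_lt, min_eq_right h]

/-- Given the root label `l`, the event asks `N l` independent copies of the tree to lie in `A`. -/
theorem prob_forall_shift_mem (S : RIFS d k) {A : Set S.Labelling} (hA : MeasurableSet A) :
    S.prob.real {τ | ∀ i : Fin S.maxN, (i : ℕ) < S.N (τ []) → S.shift τ i ∈ A} =
      S.genFun (S.prob.real A) := by
  classical
  set E := {τ : S.Labelling | ∀ i : Fin S.maxN, (i : ℕ) < S.N (τ []) → S.shift τ i ∈ A}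
  have hE : MeasurableSet E := by
    have : E = ⋂ i : Fin S.maxN, ({τ | (i : ℕ) < S.N (τ [])}ᶜ ∪ {τ | S.shift τ i ∈ A}) := by
      ext τ; simp [E, imp_iff_not_or]
    rw [this]
    exact MeasurableSet.iInter fun i =>
      (((S.measurable_N.comp S.measurable_root) (measurableSet_Ioi (a := (i : ℕ)))).compl).union
        (S.measurable_shift i hA)
  have key : S.prob E = ∫⁻ l, S.prob A ^ S.N l ∂S.μ := by
    rw [← lintegral_indicator_one hE, lintegral_prob_prod S _ (measurable_one.indicator hE)
      (fun l i => if (i : ℕ) < S.N l then A.indicator 1 else 1) ?_ ?_]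
    · refine lintegral_congr fun l => ?_
      have : ∀ i : Fin S.maxN, ∫⁻ τ, (if (i : ℕ) < S.N l then A.indicator 1 else 1 :
          S.Labelling → ℝ≥0∞) τ ∂S.prob = if (i : ℕ) < S.N l then S.prob A else 1 := fun i => by
        split_ifs
        · exact lintegral_indicator_one hA
        · simp
      simp only [this]
      rw [Finset.prod_ite, Finset.prod_const, Finset.prod_const, one_pow, mul_one,
        card_filter_lt (S.N_le l)]
    · intro l i
      split_ifs
      · exact measurable_one.indicator hA
      · exact measurable_one
    · intro τ
      by_cases hτ : τ ∈ E
      · rw [indicator_of_mem hτ, Pi.one_apply]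
        symm
        refine Finset.prod_eq_one fun i _ => ?_
        split_ifs with hi
        · exact indicator_of_mem (hτ i hi) _
        · rfl
      · rw [indicator_of_notMem hτ]
        simp only [E, mem_ofPred_eq, not_forall] at hτ
        obtain ⟨i, hi, hA⟩ := hτ
        symm
        refine Finset.prod_eq_zero (Finset.mem_univ i) ?_
        rw [if_pos hi, indicator_of_notMem hA]
  rw [measureReal_def, key, genFun, integral_eq_lintegral_of_nonneg_ae
    (Eventually.of_forall fun l => pow_nonneg measureReal_nonneg _)
    (S.integrable_comp_N fun n => S.prob.real A ^ n).aestronglyMeasurable]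
  congr 1
  refine lintegral_congr fun l => ?_
  rw [ENNReal.ofReal_pow measureReal_nonneg, measureReal_def, ENNReal.ofReal_toReal (by finiteness)]

theorem one_sub_pow_le {x : ℝ} (h0 : 0 ≤ x) (h1 : x ≤ 1) (n : ℕ) :
    (1 - x) ^ n ≤ 1 - n * x + (n : ℝ) ^ 2 * x ^ 2 := by
  induction n with
  | zero => simp
  | succ n ih =>
    have h2 := mul_le_mul_of_nonneg_right ih (sub_nonneg.2 h1)
    rw [← pow_succ] at h2
    refine h2.trans ?_
    push_cast
    have : 0 ≤ (n : ℝ) ^ 2 * x ^ 3 := by positivity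
    have : 0 ≤ (n : ℝ) * x ^ 2 := by positivity
    nlinarith [sq_nonneg x]

/-- The generating function equals `1` at `1` and has slope greater than `1` there, so it lies below
the diagonal just left of `1`; the second-order bound makes this quantitative. -/
theorem exists_genFun_lt (hne : S.NonExtinguishing) {q : ℝ} (hq0 : 0 ≤ q) (hq1 : q < 1) :
    ∃ y, q < y ∧ y < 1 ∧ S.genFun y < y := by
  set m := ∫ l, (S.N l : ℝ) ∂S.μ
  have hm : 1 < m := hne
  set M : ℝ := (S.maxN : ℝ)
  have hM : 0 ≤ M := Nat.cast_nonneg _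
  set x := min ((1 - q) / 2) ((m - 1) / (2 * (M ^ 2 + 1)))
  have hx0 : 0 < x := lt_min (by linarith) (div_pos (by linarith) (by positivity))
  have hx1 : x ≤ (1 - q) / 2 := min_le_left _ _
  have hx2 : x * (2 * (M ^ 2 + 1)) ≤ m - 1 := by
    have := min_le_right ((1 - q) / 2) ((m - 1) / (2 * (M ^ 2 + 1)))
    rwa [le_div_iff₀ (by positivity)] at this
  refine ⟨1 - x, by linarith, by linarith, ?_⟩
  have h1 : S.genFun (1 - x) ≤ ∫ l, ((1 + M ^ 2 * x ^ 2) - x * (S.N l : ℝ)) ∂S.μ := by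
    refine integral_mono (S.integrable_comp_N fun n => (1 - x) ^ n)
      (S.integrable_comp_N fun n => (1 + M ^ 2 * x ^ 2) - x * (n : ℝ)) fun l => ?_
    have h2 := one_sub_pow_le hx0.le (by linarith) (S.N l)
    have h3 : (S.N l : ℝ) ^ 2 ≤ M ^ 2 :=
      pow_le_pow_left₀ (Nat.cast_nonneg _) (Nat.cast_le.2 (S.N_le l)) 2
    have h4 := mul_le_mul_of_nonneg_right h3 (sq_nonneg x)
    dsimp only
    linarith
  rw [integral_sub (integrable_const _) ((S.integrable_comp_N fun n => (n : ℝ)).const_mul x),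
    integral_const_mul] at h1
  simp only [integral_const, probReal_univ, one_smul] at h1
  have h5 : M ^ 2 * x < m - 1 := by nlinarith
  have h6 : (M ^ 2 * x) * x < (m - 1) * x := mul_lt_mul_of_pos_right h5 hx0
  have h7 : S.genFun (1 - x) ≤ 1 + M ^ 2 * x ^ 2 - x * m := h1
  nlinarith

theorem genFun_convex {p y α β : ℝ} (hp : 0 ≤ p) (hy : 0 ≤ y) (hα : 0 ≤ α) (hβ : 0 ≤ β)
    (hαβ : α + β = 1) : S.genFun (α * p + β * y) ≤ α * S.genFun p + β * S.genFun y := by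
  unfold genFun
  rw [← integral_const_mul, ← integral_const_mul, ← integral_add
    ((S.integrable_comp_N fun n => p ^ n).const_mul α)
    ((S.integrable_comp_N fun n => y ^ n).const_mul β)]
  refine integral_mono (S.integrable_comp_N fun n => (α * p + β * y) ^ n)
    (S.integrable_comp_N fun n => α * p ^ n + β * y ^ n) fun l => ?_
  simpa using (convexOn_pow (𝕜 := ℝ) (S.N l)).2 hp hy hα hβ hαβ

/-- If `p < q`, then `q` lies strictly between `p` and a point `y < 1` where the generating function
is strictly below the diagonal. Convexity then puts it strictly below the diagonal at `q` too. -/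
theorem le_of_le_genFun (hne : S.NonExtinguishing) {p q : ℝ} (hp0 : 0 ≤ p) (hp : S.genFun p ≤ p)
    (hq1 : q < 1) (hq : q ≤ S.genFun q) : q ≤ p := by
  by_contra! hpq
  obtain ⟨y, hqy, -, hy⟩ := exists_genFun_lt hne (hp0.trans hpq.le) hq1
  have hyp : 0 < y - p := by linarith
  set α := (y - q) / (y - p)
  have hα0 : 0 ≤ α := div_nonneg (by linarith) hyp.le
  have hα1 : 0 < 1 - α := by
    have : α < 1 := (div_lt_one hyp).2 (by linarith)
    linarith
  have heq : α * p + (1 - α) * y = q := by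
    have : α * (y - p) = y - q := div_mul_cancel₀ _ hyp.ne'
    linarith
  have h1 := genFun_convex (S := S) hp0 (by linarith : 0 ≤ y) hα0 hα1.le (by ring)
  rw [heq] at h1
  have h2 := mul_le_mul_of_nonneg_left hp hα0
  have h3 := mul_lt_mul_of_pos_left hy hα1
  linarith

/-- On survival, almost surely some node has its subtree labelling in a given set of positive
probability of surviving labellings. -/
theorem ae_exists_sub_mem (hne : S.NonExtinguishing) {E : Set S.Labelling} (hE : MeasurableSet E)
    (hEa : E ⊆ S.alive) (hpos : 0 < S.prob.real E) :
    ∀ᵐ τ ∂S.prob, τ ∈ S.alive → ∃ v, S.IsCoding τ v ∧ S.sub τ v ∈ E := by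
  set B : Set S.Labelling := {τ | ∀ v, S.IsCoding τ v → S.sub τ v ∉ E}
  have hB : MeasurableSet B := by
    have : B = ⋂ v, ({τ | S.IsCoding τ v}ᶜ ∪ {τ | S.sub τ v ∈ E}ᶜ) := by
      ext τ; simp [B, imp_iff_not_or]
    rw [this]
    exact MeasurableSet.iInter fun v =>
      (measurableSet_isCoding v).compl.union (S.measurable_sub v hE).compl
  have hX : MeasurableSet S.aliveᶜ := S.measurableSet_alive.compl
  have hXB : S.aliveᶜ ⊆ B := fun τ hτ v hv hvE => hτ (mem_alive_of_sub hv (hEa hvE))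
  have hq1 : S.prob.real B < 1 := by
    have : B ⊆ Eᶜ := fun τ hτ => hτ [] trivial
    have h1 := measureReal_mono (μ := S.prob) this
    rw [probReal_compl_eq_one_sub hE] at h1
    linarith
  -- The event `B` that no node has its subtree in `E` passes to the children, and extinction is
  -- inherited from them. So `P(B)` and the extinction probability satisfy opposite inequalities,
  -- which forces `P(B)` down to the latter.
  have hq : S.prob.real B ≤ S.genFun (S.prob.real B) := by
    rw [← S.prob_forall_shift_mem hB]
    refine measureReal_mono fun τ hτ i hi v hv => ?_
    exact hτ (i :: v) ⟨hi, hv⟩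
  have hp : S.genFun (S.prob.real S.aliveᶜ) ≤ S.prob.real S.aliveᶜ := by
    rw [← S.prob_forall_shift_mem hX]
    refine measureReal_mono fun τ hτ ha => ?_
    obtain ⟨i, hi, hai⟩ := exists_shift_mem_alive ha
    exact hτ i hi hai
  have hle := le_of_le_genFun hne measureReal_nonneg hp hq1 hq
  have hzero : S.prob (B \ S.aliveᶜ) = 0 := by
    have h1 := measureReal_sdiff (μ := S.prob) hXB hX
    have h2 : S.prob.real (B \ S.aliveᶜ) = 0 :=
      le_antisymm (by linarith) measureReal_nonneg
    exact (measureReal_eq_zero_iff (by finiteness)).1 h2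
  have := measure_eq_zero_iff_ae_notMem.1 hzero
  filter_upwards [this] with τ hτ ha
  by_contra! hcon
  exact hτ ⟨hcon, fun h => h ha⟩

/-! ### Lower bound for stopping lines -/

theorem cutCount_sub_le (h : S.IsRatio c a b) {D : Set S.Labelling} {τ : S.Labelling}
    {v : List (Fin S.maxN)} (hv : S.IsCoding τ v) {ξ : ℝ} (hξ0 : 0 < ξ)
    (hξ : ξ < S.cratio c τ v) :
    S.cutCount c D (ξ / S.cratio c τ v) (S.sub τ v) ≤ S.cutCount c D ξ τ := by
  rw [cutCount, cutCount, ← Set.ncard_image_of_injective _ (List.append_right_injective v)]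
  refine Set.ncard_le_ncard ?_ (cutSet_finite h D hξ0 τ)
  rintro _ ⟨w, hw, rfl⟩
  exact ⟨hw.1.append h hv hξ, by rw [sub_append]; exact hw.2⟩

/-- `E` is the set of labellings rich at every depth. The gap between `t` and `t'` pays for the
constants `x / 4` and `a`. -/
theorem exists_prob_pos_le_cutCount (h : S.IsRatio c a b) {t t' : ℝ} (ht : 0 ≤ t) (htt : t < t')
    (hm : 1 < S.meanSum c t') :
    ∃ E : Set S.Labelling, MeasurableSet E ∧ E ⊆ S.alive ∧ 0 < S.prob.real E ∧
      ∃ C > 0, ∀ τ ∈ E, ∀ ξ : ℝ, 0 < ξ → ξ ≤ 1 → C * ξ ^ (-t) ≤ S.cutCount c S.alive ξ τ := by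
  have hκ := expRange_pos hm.ne'
  set κ := S.expRange c t'
  set x := 1 - Real.exp (-(κ / 2)) with hx
  have hx0 : 0 < x := by
    have : Real.exp (-(κ / 2)) < 1 := by
      rw [← Real.exp_zero]; exact Real.exp_lt_exp.2 (by linarith)
    linarith
  have ht' : 0 < t' := ht.trans_lt htt
  have hat : 0 < a ^ t := Real.rpow_pos_of_pos h.pos t
  -- The first condition keeps `u ≤ 1` in the richness estimate. The second gives `p ≥ (a * η) ^
  -- (-t)`: the branching makes up for the largest possible loss of scale.
  obtain ⟨η, ⟨hη1, hη2⟩, hη⟩ : ∃ η : ℝ, (κ ≤ x / 2 * η ^ (-t') ∧ 1 / a ^ t ≤ x / 4 * η ^ (-(t' - t)))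
      ∧ η ∈ Ioo (0 : ℝ) 1 := by
    have h1 : Tendsto (fun η : ℝ => x / 2 * η ^ (-t')) (𝓝[>] 0) atTop :=
      (tendsto_rpow_neg_nhdsGT_zero (by linarith)).const_mul_atTop (by positivity)
    have h2 : Tendsto (fun η : ℝ => x / 4 * η ^ (-(t' - t))) (𝓝[>] 0) atTop :=
      (tendsto_rpow_neg_nhdsGT_zero (by linarith)).const_mul_atTop (by positivity)
    exact (((h1.eventually_ge_atTop κ).and (h2.eventually_ge_atTop (1 / a ^ t))).and
      (Ioo_mem_nhdsGT one_pos)).exists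
  set p := x / 4 * η ^ (-t') with hp
  have hηt : 0 < η ^ (-t') := Real.rpow_pos_of_pos hη.1 _
  have hp0 : 0 < p := by positivity
  set z := a * η
  have hz0 : 0 < z := mul_pos h.pos hη.1
  have hz1 : z < 1 := (mul_lt_of_lt_one_left hη.1 (h.ab.trans_lt h.lt_one)).trans hη.2
  have hpz : z ^ (-t) ≤ p := by
    have h1 : η ^ (-t') = η ^ (-(t' - t)) * η ^ (-t) := by
      rw [← Real.rpow_add hη.1]; ring_nf
    have h2 : z ^ (-t) = 1 / a ^ t * η ^ (-t) := by
      rw [Real.mul_rpow h.pos.le hη.1.le, Real.rpow_neg h.pos.le, one_div]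
    rw [h2, hp, h1, ← mul_assoc]
    exact mul_le_mul_of_nonneg_right hη2 (Real.rpow_nonneg hη.1.le _)
  refine ⟨⋂ n, S.richSet c η p n, MeasurableSet.iInter (measurableSet_richSet h hη.1 p),
    iInter_richSet_subset_alive h hη.1 hη.2 hp0, ?_, z ^ t, Real.rpow_pos_of_pos hz0 t, ?_⟩
  · have hlim := tendsto_measure_iInter_atTop (μ := S.prob)
      (fun n => (measurableSet_richSet h hη.1 p n).nullMeasurableSet)
      (richSet_antitone h hη.1 p) ⟨0, by finiteness⟩
    have h1 : ENNReal.ofReal x ≤ S.prob (⋂ n, S.richSet c η p n) := by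
      refine ge_of_tendsto' hlim fun n => ?_
      rw [Function.comp_apply, ← ofReal_measureReal (by finiteness)]
      exact ENNReal.ofReal_le_ofReal (le_prob_richSet h ht'.le hm hx hη.1 hη.2.le hη1 n)
    have h2 := ENNReal.toReal_mono (by finiteness) h1
    rw [ENNReal.toReal_ofReal hx0.le] at h2
    exact hx0.trans_le h2
  · intro τ hτ ξ hξ hξ1
    obtain ⟨n, hn1, hn2⟩ := exists_nat_pow_near_of_lt_one hξ hξ1 hz0 hz1
    refine le_trans ?_ (pow_le_cutCount_alive h hη.1 hη.2 hp0 hξ hn2 hτ)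
    have h1 : ξ ^ (-t) ≤ (z ^ (n + 1)) ^ (-t) :=
      Real.rpow_le_rpow_of_nonpos (pow_pos hz0 _) hn1.le (by linarith)
    have h2 : (z ^ (n + 1)) ^ (-t) = (z ^ (-t)) ^ (n + 1) := by
      rw [← Real.rpow_natCast, ← Real.rpow_natCast, ← Real.rpow_mul hz0.le,
        ← Real.rpow_mul hz0.le, mul_comm]
    calc z ^ t * ξ ^ (-t) ≤ z ^ t * (z ^ (-t)) ^ (n + 1) := by rw [← h2]; gcongr
      _ = (z ^ (-t)) ^ n := by
        rw [pow_succ, mul_comm, mul_assoc, ← Real.rpow_add hz0]; simp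
      _ ≤ p ^ n := pow_le_pow_left₀ (Real.rpow_nonneg hz0.le _) hpz n

/-- Almost surely on survival, for every exponent below the critical one, the stopping lines
contain polynomially many surviving nodes. -/
theorem ae_le_cutCount_alive (h : S.IsRatio c a b) (hne : S.NonExtinguishing) {s : ℝ}
    (hm : ∀ t, 0 ≤ t → t < s → 1 < S.meanSum c t) :
    ∀ᵐ τ ∂S.prob, τ ∈ S.alive → ∀ t, 0 ≤ t → t < s → ∃ C > 0, ∃ ξ₀ > 0, ∀ ξ : ℝ, 0 < ξ → ξ < ξ₀ →
      C * ξ ^ (-t) ≤ S.cutCount c S.alive ξ τ := by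
  have key : ∀ t, 0 ≤ t → t < s → ∀ᵐ τ ∂S.prob, τ ∈ S.alive →
      ∃ C > 0, ∃ ξ₀ > 0, ∀ ξ : ℝ, 0 < ξ → ξ < ξ₀ → C * ξ ^ (-t) ≤ S.cutCount c S.alive ξ τ := by
    intro t ht hts
    obtain ⟨E, hE, hEa, hpos, C, hC, hEC⟩ := exists_prob_pos_le_cutCount h ht
      (by linarith : t < (t + s) / 2) (hm _ (by linarith) (by linarith))
    filter_upwards [ae_exists_sub_mem hne hE hEa hpos] with τ hτ ha
    obtain ⟨v, hv, hvE⟩ := hτ ha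
    have hr := cratio_pos h τ v
    set r := S.cratio c τ v
    -- One rich subtree suffices: its lines embed in those of the whole tree, with `ξ` rescaled by
    -- the ratio `r` of its root.
    refine ⟨C * r ^ t, mul_pos hC (Real.rpow_pos_of_pos hr t), r, hr, fun ξ hξ0 hξ => ?_⟩
    have h1 := hEC _ hvE (ξ / r) (div_pos hξ0 hr) ((div_le_one hr).2 hξ.le)
    have h2 : (S.cutCount c S.alive (ξ / r) (S.sub τ v) : ℝ) ≤ S.cutCount c S.alive ξ τ :=
      Nat.cast_le.2 (cutCount_sub_le h hv hξ0 hξ)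
    refine le_trans (le_of_eq ?_) (h1.trans h2)
    rw [Real.div_rpow hξ0.le hr.le, Real.rpow_neg hr.le, div_inv_eq_mul]; ring
  have hall : ∀ᵐ τ ∂S.prob, ∀ j : ℕ, τ ∈ S.alive → 0 ≤ s - 1 / ((j : ℝ) + 1) →
      ∃ C > 0, ∃ ξ₀ > 0, ∀ ξ : ℝ, 0 < ξ → ξ < ξ₀ →
        C * ξ ^ (-(s - 1 / ((j : ℝ) + 1))) ≤ S.cutCount c S.alive ξ τ := by
    refine ae_all_iff.2 fun j => ?_
    by_cases hj : 0 ≤ s - 1 / ((j : ℝ) + 1)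
    · have : (0 : ℝ) < 1 / ((j : ℝ) + 1) := by positivity
      filter_upwards [key _ hj (by linarith)] with τ hτ ha _ using hτ ha
    · exact Eventually.of_forall fun τ _ h0 => absurd h0 hj
  filter_upwards [hall] with τ hτ ha t ht hts
  obtain ⟨j, hj⟩ := exists_nat_one_div_lt (sub_pos.2 hts)
  obtain ⟨C, hC, ξ₀, hξ₀, hle⟩ := hτ j ha (by linarith)
  refine ⟨C, hC, min ξ₀ 1, lt_min hξ₀ one_pos, fun ξ h0 h1 => ?_⟩
  refine le_trans ?_ (hle ξ h0 (h1.trans_le (min_le_left _ _)))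
  refine mul_le_mul_of_nonneg_left ?_ hC.le
  exact Real.rpow_le_rpow_of_exponent_ge h0 (h1.le.trans (min_le_right _ _)) (by linarith)

/-! ### The critical exponent -/

theorem meanSum_add_le (h : S.IsRatio c a b) {t u : ℝ} (ht : 0 ≤ t) (hu : 0 ≤ u) :
    S.meanSum c (t + u) ≤ b ^ u * S.meanSum c t := by
  unfold meanSum
  rw [← integral_const_mul]
  refine integral_mono (integrable_ratioSum h (add_nonneg ht hu))
    ((integrable_ratioSum h ht).const_mul _) fun l => ?_
  simp only [ratioSum, Finset.mul_sum]
  refine Finset.sum_le_sum fun i _ => ?_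
  split_ifs
  · rw [add_comm, Real.rpow_add (h.c_pos l i)]
    exact mul_le_mul_of_nonneg_right (Real.rpow_le_rpow (h.c_pos l i).le (h.le l i) hu)
      (Real.rpow_nonneg (h.c_pos l i).le _)
  · simp

theorem meanSum_zero : S.meanSum c 0 = ∫ l, (S.N l : ℝ) ∂S.μ := by
  unfold meanSum
  refine integral_congr_ae (Eventually.of_forall fun l => ?_)
  simp only [ratioSum, Real.rpow_zero]
  rw [Finset.sum_boole, card_filter_lt (S.N_le l)]

/-- Raising the exponent by `u` multiplies the mean by at most `b ^ u < 1`, so it cannot linger at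
`1`. At exponent `0` it is the expected number of maps, which exceeds `1`. -/
theorem exists_critical (h : S.IsRatio c a b) (hne : S.NonExtinguishing) :
    ∃ s : ℝ, 0 ≤ s ∧ (∀ t, 0 ≤ t → t < s → 1 < S.meanSum c t) ∧
      ∀ t, s < t → S.meanSum c t < 1 := by
  set A : Set ℝ := {t | 0 ≤ t ∧ 1 < S.meanSum c t}
  have h0 : (0 : ℝ) ∈ A := ⟨le_rfl, by rw [meanSum_zero]; exact hne⟩
  have hnn : ∀ t, 0 ≤ S.meanSum c t := fun t => integral_nonneg fun l => ratioSum_nonneg h t l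
  have hmono : ∀ t u, 0 ≤ t → t ≤ u → S.meanSum c u ≤ S.meanSum c t := fun t u ht htu => by
    have h1 := meanSum_add_le h ht (sub_nonneg.2 htu)
    rw [add_sub_cancel] at h1
    exact h1.trans (mul_le_of_le_one_left (hnn t)
      (Real.rpow_le_one h.b_pos.le h.lt_one.le (sub_nonneg.2 htu)))
  have hbdd : BddAbove A := by
    have hlim : Tendsto (fun n : ℕ => b ^ n * S.meanSum c 0) atTop (𝓝 0) := by
      simpa using (tendsto_pow_atTop_nhds_zero_of_lt_one h.b_pos.le h.lt_one).mul_const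
        (S.meanSum c 0)
    obtain ⟨n, hn⟩ := (hlim.eventually_le_const one_pos).exists
    refine ⟨n, fun t ht => ?_⟩
    by_contra! hcon
    have h1 := meanSum_add_le h le_rfl (Nat.cast_nonneg n (α := ℝ))
    rw [zero_add, Real.rpow_natCast] at h1
    have := ht.2.trans_le (hmono n t (Nat.cast_nonneg n) hcon.le)
    linarith
  refine ⟨sSup A, le_csSup hbdd h0, fun t ht hts => ?_, fun t hst => ?_⟩
  · obtain ⟨u, hu, htu⟩ := exists_lt_of_lt_csSup ⟨0, h0⟩ hts
    exact hu.2.trans_le (hmono t u ht htu.le)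
  · have hs0 : 0 ≤ sSup A := le_csSup hbdd h0
    set u := (sSup A + t) / 2
    have hu : S.meanSum c u ≤ 1 := by
      by_contra! hcon
      have : u ≤ sSup A := le_csSup hbdd ⟨by simp only [u]; linarith, hcon⟩
      simp only [u] at this
      linarith
    have hut : 0 < t - u := by simp only [u]; linarith
    have h1 := meanSum_add_le h (by simp only [u]; linarith : 0 ≤ u) hut.le
    rw [add_sub_cancel] at h1
    calc S.meanSum c t ≤ b ^ (t - u) * S.meanSum c u := h1
      _ ≤ b ^ (t - u) := mul_le_of_le_one_right (Real.rpow_nonneg h.b_pos.le _) hu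
      _ < 1 := Real.rpow_lt_one h.b_pos.le h.lt_one hut

end RIFS

/-! ### Geometry of the pieces under the open set condition -/

/-- After rescaling, `f` is an isometry of a strictly convex space, hence affine, and an injective
linear endomorphism in finite dimension is onto. -/
theorem surjective_of_dist_eq_mul {E : Type*} [NormedAddCommGroup E] [NormedSpace ℝ E]
    [StrictConvexSpace ℝ E] [FiniteDimensional ℝ E] {f : E → E} {r : ℝ} (hr : 0 < r)
    (hf : ∀ x y, dist (f x) (f y) = r * dist x y) : Function.Surjective f := by
  have hi : Isometry fun x => r⁻¹ • f x := Isometry.of_dist_eq fun x y => by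
    rw [dist_smul₀, hf, norm_inv, Real.norm_of_nonneg hr.le, inv_mul_cancel_left₀ hr.ne']
  set g := hi.affineIsometryOfStrictConvexSpace
  have hg : Function.Surjective g.toAffineMap := by
    rw [← AffineMap.linear_surjective_iff, ← LinearMap.injective_iff_surjective]
    exact g.linearIsometry.injective
  intro y
  obtain ⟨x, hx⟩ := hg (r⁻¹ • y)
  refine ⟨x, ?_⟩
  have hx' : r⁻¹ • f x = r⁻¹ • y := hx
  exact smul_right_injective E (inv_ne_zero hr.ne') hx'

namespace RIFS

variable {d k : ℕ} {S : RIFS d k} {c : S.Λ → Fin S.maxN → ℝ} {a b : ℝ}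

/-- `c` gives the contraction ratios of the maps of the system. -/
def Scales (S : RIFS d k) (c : S.Λ → Fin S.maxN → ℝ) : Prop :=
  ∀ (l : S.Λ) (i : Fin S.maxN), (i : ℕ) < S.N l →
    ∀ x y, dist (S.f l i x) (S.f l i y) = c l i * dist x y

theorem Scales.dist_codingMap (hc : S.Scales c) {τ : S.Labelling} {v : List (Fin S.maxN)}
    (hv : S.IsCoding τ v) (x y : EuclideanSpace ℝ (Fin d)) :
    dist (S.codingMap τ v x) (S.codingMap τ v y) = S.cratio c τ v * dist x y := by
  induction v generalizing τ with
  | nil => simp [codingMap, cratio]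
  | cons i v ih =>
    simp only [codingMap, cratio, Function.comp_apply]
    rw [hc _ _ hv.1, ih hv.2, mul_assoc]

theorem codingMap_image_subset {A : Set (EuclideanSpace ℝ (Fin d))}
    (hA : ∀ (l : S.Λ) (i : Fin S.maxN), (i : ℕ) < S.N l → S.f l i '' A ⊆ A)
    {τ : S.Labelling} {v : List (Fin S.maxN)} (hv : S.IsCoding τ v) :
    S.codingMap τ v '' A ⊆ A := by
  induction v generalizing τ with
  | nil => simp [codingMap]
  | cons i v ih =>
    rw [codingMap, image_comp]
    exact (image_mono (ih hv.2)).trans (hA _ _ hv.1)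

theorem codingMap_append_image_subset {A : Set (EuclideanSpace ℝ (Fin d))}
    (hA : ∀ (l : S.Λ) (i : Fin S.maxN), (i : ℕ) < S.N l → S.f l i '' A ⊆ A)
    {τ : S.Labelling} {v w : List (Fin S.maxN)} (hv : S.IsCoding τ (v ++ w)) :
    S.codingMap τ (v ++ w) '' A ⊆ S.codingMap τ v '' A := by
  rw [codingMap_append, image_comp]
  exact image_mono (codingMap_image_subset hA ((isCoding_append _ _ _).1 hv).2)

/-- No node of a stopping line is a proper prefix of another, so distinct nodes branch at a common
ancestor, where the images of `O` are disjoint. -/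
theorem eq_of_image_inter_nonempty (h : S.IsRatio c a b) (hc : S.Scales c)
    {O : Set (EuclideanSpace ℝ (Fin d))}
    (hO : ∀ (l : S.Λ) (i : Fin S.maxN), (i : ℕ) < S.N l → S.f l i '' O ⊆ O)
    (hdisj : ∀ (l : S.Λ) (i j : Fin S.maxN), (i : ℕ) < S.N l → (j : ℕ) < S.N l →
      (S.f l i '' O ∩ S.f l j '' O).Nonempty → i = j)
    {ξ : ℝ} {τ : S.Labelling} {v w : List (Fin S.maxN)} (hv : S.InCut c ξ τ v)
    (hw : S.InCut c ξ τ w) (hne : (S.codingMap τ v '' O ∩ S.codingMap τ w '' O).Nonempty) :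
    v = w := by
  induction v generalizing τ ξ w with
  | nil => exact (InCut.eq_nil hv hw).symm
  | cons i v ih =>
    cases w with
    | nil => exact absurd hv.1 (not_lt.2 hw)
    | cons j w =>
      obtain ⟨x, hx1, hx2⟩ := hne
      rw [codingMap, image_comp] at hx1 hx2
      obtain rfl : i = j := hdisj _ _ _ hv.2.1 hw.2.1
        ⟨x, image_mono (codingMap_image_subset hO hv.2.2.isCoding) hx1,
          image_mono (codingMap_image_subset hO hw.2.2.isCoding) hx2⟩
      have hinj : Function.Injective (S.f (τ []) i) := fun y z hyz => by
        have := hc _ _ hv.2.1 y z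
        rw [hyz, dist_self] at this
        exact dist_eq_zero.1 ((mul_eq_zero.1 this.symm).resolve_left (h.c_pos _ _).ne')
      rw [ih hv.2.2 hw.2.2 ?_]
      rw [← image_nonempty (f := S.f (τ []) i), image_inter hinj]
      exact ⟨x, hx1, hx2⟩

theorem ball_subset_codingMap_image (h : S.IsRatio c a b) (hc : S.Scales c) {τ : S.Labelling}
    {v : List (Fin S.maxN)} (hv : S.IsCoding τ v) (y : EuclideanSpace ℝ (Fin d)) (ρ : ℝ) :
    Metric.ball (S.codingMap τ v y) (S.cratio c τ v * ρ) ⊆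
      S.codingMap τ v '' Metric.ball y ρ := by
  intro z hz
  have hr := cratio_pos h τ v
  obtain ⟨x, rfl⟩ := surjective_of_dist_eq_mul hr (hc.dist_codingMap hv) z
  refine ⟨x, ?_, rfl⟩
  rw [Metric.mem_ball, hc.dist_codingMap hv] at hz
  exact lt_of_mul_lt_mul_left hz hr.le

/-- The pieces of a stopping line have bounded overlap. -/
theorem exists_overlap_bound (h : S.IsRatio c a b) (hc : S.Scales c) (hO : S.UOSC)
    {Δ : Set (EuclideanSpace ℝ (Fin d))} (hΔ : IsCompact Δ) :
    ∃ K : ℕ, ∀ (τ : S.Labelling) (ξ : ℝ), 0 < ξ → ξ ≤ 1 → ∀ x : EuclideanSpace ℝ (Fin d),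
      {v | S.InCut c ξ τ v ∧
        (S.codingMap τ v '' Δ ∩ Metric.ball x (2 * ξ)).Nonempty}.ncard ≤ K := by
  obtain ⟨O, hOo, ⟨y, hy⟩, hOs, hOd⟩ := hO
  obtain ⟨ρ, hρ, hball⟩ := Metric.isOpen_iff.1 hOo y hy
  obtain ⟨D, hD⟩ := hΔ.isBounded.subset_closedBall y
  have haρ : 0 < a * ρ / 2 := by have := h.pos; positivity
  obtain ⟨t, ht, hcov⟩ := Metric.totallyBounded_iff.1
    (isCompact_closedBall (0 : EuclideanSpace ℝ (Fin d)) (D + 2)).totallyBounded _ haρ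
  refine ⟨t.ncard, fun τ ξ hξ hξ1 x => ?_⟩
  set V := {v | S.InCut c ξ τ v ∧ (S.codingMap τ v '' Δ ∩ Metric.ball x (2 * ξ)).Nonempty}
  -- Rescaling by `ξ⁻¹` makes the bound independent of the scale. The centres `f_v(y)` stay in a
  -- fixed ball, and they are `a * ρ`-separated because the image of `O` under `f_v` contains the
  -- ball of radius `a * ξ * ρ` around `f_v(y)`.
  set φ : List (Fin S.maxN) → EuclideanSpace ℝ (Fin d) := fun v => ξ⁻¹ • (S.codingMap τ v y - x)
  have hφ : ∀ v ∈ V, φ v ∈ Metric.closedBall (0 : EuclideanSpace ℝ (Fin d)) (D + 2) := by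
    rintro v ⟨hv, _, ⟨z, hz, rfl⟩, hzx⟩
    rw [mem_closedBall_zero_iff, norm_smul, norm_inv, Real.norm_of_nonneg hξ.le,
      inv_mul_le_iff₀ hξ, ← dist_eq_norm]
    have h1 := hc.dist_codingMap hv.isCoding y z
    have h2 : S.cratio c τ v * dist y z ≤ ξ * D := by
      refine mul_le_mul (hv.cratio_bounds h hξ hξ1).2 ?_ dist_nonneg hξ.le
      rw [dist_comm]; exact hD hz
    have h3 := dist_triangle (S.codingMap τ v y) (S.codingMap τ v z) x
    rw [Metric.mem_ball] at hzx
    linarith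
  have hsep : ∀ v ∈ V, ∀ w ∈ V, dist (φ v) (φ w) < a * ρ → v = w := by
    intro v hv w hw hvw
    refine eq_of_image_inter_nonempty h hc hOs hOd hv.1 hw.1
      ⟨S.codingMap τ w y, ?_, mem_image_of_mem _ hy⟩
    refine image_mono hball (ball_subset_codingMap_image h hc hv.1.isCoding y ρ ?_)
    simp only [φ] at hvw
    rw [dist_smul₀, norm_inv, Real.norm_of_nonneg hξ.le, dist_sub_right, inv_mul_lt_iff₀ hξ,
      dist_comm] at hvw
    have := mul_le_mul_of_nonneg_right (hv.1.cratio_bounds h hξ hξ1).1.le hρ.le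
    rw [Metric.mem_ball]
    linarith
  have hch : ∀ v ∈ V, ∃ p ∈ t, dist (φ v) p < a * ρ / 2 := fun v hv => by
    simpa using hcov (hφ v hv)
  choose! p hpt hp using hch
  refine Set.ncard_le_ncard_of_injOn p hpt (fun v hv w hw hvw => hsep v hv w hw ?_) ht
  have h1 := hp v hv
  have h2 := hp w hw
  rw [hvw] at h1
  linarith [dist_triangle_right (φ v) (φ w) (p w)]

/-! ### The random set -/

variable {Δ : Set (EuclideanSpace ℝ (Fin d))}

theorem randomSet_subset_seed (hΔ : S.IsSeed Δ) (τ : S.Labelling) : S.randomSet Δ τ ⊆ Δ := by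
  intro x hx
  obtain ⟨v, hv, hxv⟩ := mem_iUnion₂.1 (mem_iInter₂.1 hx 1 le_rfl)
  exact codingMap_image_subset hΔ.2.2 hv.2 hxv

theorem totallyBounded_randomSet (hΔ : S.IsSeed Δ) (τ : S.Labelling) :
    TotallyBounded (S.randomSet Δ τ) :=
  hΔ.1.totallyBounded.subset (randomSet_subset_seed hΔ τ)

theorem isCoding_take {τ : S.Labelling} {v : List (Fin S.maxN)} (hv : S.IsCoding τ v) (n : ℕ) :
    S.IsCoding τ (v.take n) := by
  rw [← List.take_append_drop n v] at hv
  exact ((isCoding_append _ _ _).1 hv).1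

theorem randomSet_eq_empty {τ : S.Labelling} (hτ : τ ∉ S.alive) : S.randomSet Δ τ = ∅ := by
  simp only [alive, mem_ofPred_eq] at hτ
  push Not at hτ
  obtain ⟨n, hn⟩ := hτ
  refine eq_empty_of_forall_notMem fun x hx => ?_
  obtain ⟨v, hv, -⟩ := mem_iUnion₂.1 (mem_iInter₂.1 hx (n + 1) (by omega))
  exact hn v (by omega) hv.2

/-- Cantor's intersection theorem for the level unions, which are compact, non-empty and decreasing.
-/
theorem randomSet_nonempty (hc : S.Scales c) (hΔ : S.IsSeed Δ)
    {τ : S.Labelling} (hτ : τ ∈ S.alive) : (S.randomSet Δ τ).Nonempty := by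
  set K : ℕ → Set (EuclideanSpace ℝ (Fin d)) := fun n =>
    ⋃ v ∈ {v : List (Fin S.maxN) | v.length = n ∧ S.IsCoding τ v}, S.codingMap τ v '' Δ
  have hcompact : ∀ n, IsCompact (K n) := fun n => by
    refine ((List.finite_length_eq (Fin S.maxN) n).subset fun v hv => hv.1).isCompact_biUnion
      fun v hv => hΔ.1.image ?_
    refine (LipschitzWith.of_dist_le_mul (K := (S.cratio c τ v).toNNReal) fun x y => ?_).continuous
    rw [hc.dist_codingMap hv.2]
    exact mul_le_mul_of_nonneg_right (Real.le_coe_toNNReal _) dist_nonneg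
  have hne : ∀ n, (K n).Nonempty := fun n => by
    obtain ⟨v, hn, hv⟩ := hτ n
    obtain ⟨z, hz⟩ := hΔ.2.1
    exact ⟨_, mem_biUnion (x := v.take n) ⟨by simpa using hn, isCoding_take hv n⟩
      (mem_image_of_mem _ hz)⟩
  have hanti : ∀ n, K (n + 1) ⊆ K n := fun n x hx => by
    obtain ⟨v, ⟨hvl, hv⟩, hxv⟩ := mem_iUnion₂.1 hx
    refine mem_iUnion₂.2 ⟨v.take n, ⟨by simp; omega, isCoding_take hv n⟩, ?_⟩
    rw [← List.take_append_drop n v] at hv hxv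
    exact codingMap_append_image_subset hΔ.2.2 hv hxv
  obtain ⟨x, hx⟩ := IsCompact.nonempty_iInter_of_sequence_nonempty_isCompact_isClosed K hanti hne
    (hcompact 0) fun n => (hcompact n).isClosed
  exact ⟨x, mem_iInter₂.2 fun n _ => mem_iInter.1 hx n⟩

theorem codingMap_mem_randomSet (hΔ : S.IsSeed Δ) {τ : S.Labelling} {v : List (Fin S.maxN)}
    (hv : S.IsCoding τ v) {x : EuclideanSpace ℝ (Fin d)} (hx : x ∈ S.randomSet Δ (S.sub τ v)) :
    S.codingMap τ v x ∈ S.randomSet Δ τ := by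
  refine mem_iInter₂.2 fun n hn => ?_
  rcases le_or_gt n v.length with h1 | h1
  · refine mem_iUnion₂.2 ⟨v.take n, ⟨by simpa using h1, isCoding_take hv n⟩, ?_⟩
    have hmem : S.codingMap τ v x ∈ S.codingMap τ v '' Δ :=
      mem_image_of_mem _ (randomSet_subset_seed hΔ _ hx)
    have hv' : S.IsCoding τ (v.take n ++ v.drop n) := by rwa [List.take_append_drop]
    have := codingMap_append_image_subset hΔ.2.2 hv'
    rw [List.take_append_drop] at this
    exact this hmem
  · obtain ⟨w, ⟨hwl, hw⟩, z, hz, hzx⟩ :=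
      mem_iUnion₂.1 (mem_iInter₂.1 hx (n - v.length) (by omega))
    refine mem_iUnion₂.2 ⟨v ++ w, ⟨by simp; omega, (isCoding_append _ _ _).2 ⟨hv, hw⟩⟩, z, hz, ?_⟩
    rw [codingMap_append, Function.comp_apply, hzx]

/-- Lines at `R` and then at `ξ` are reached within `n + m` steps when `b ^ n < R` and `b ^ m < ξ`,
so a finite code suffices. The intersection starts at level `1`, hence level `n + m + 1`. -/
theorem exists_prefix_mem (h : S.IsRatio c a b) (hΔ : S.IsSeed Δ) {τ : S.Labelling}
    {x : EuclideanSpace ℝ (Fin d)} (hx : x ∈ S.randomSet Δ τ) {R ξ : ℝ} (hR : 0 < R) (hξ : 0 < ξ) :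
    ∃ v w, S.InCut c R τ v ∧ S.InCut c ξ (S.sub τ v) w ∧ x ∈ S.codingMap τ (v ++ w) '' Δ := by
  obtain ⟨n, hn⟩ := exists_pow_lt_of_lt_one hR h.lt_one
  obtain ⟨m, hm⟩ := exists_pow_lt_of_lt_one hξ h.lt_one
  obtain ⟨u, ⟨hul, hu⟩, hxu⟩ := mem_iUnion₂.1 (mem_iInter₂.1 hx (n + m + 1) (by omega))
  obtain ⟨v, w, rfl, hv⟩ := exists_inCut_prefix h hn.le hu (by omega)
  have hvl := hv.length_le h hn.le
  have hw := ((isCoding_append _ _ _).1 hu).2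
  obtain ⟨w, z, rfl, hw'⟩ := exists_inCut_prefix h hm.le hw (by
    rw [List.length_append] at hul; omega)
  refine ⟨v, w, hv, hw', ?_⟩
  rw [← List.append_assoc] at hu hxu
  exact codingMap_append_image_subset hΔ.2.2 hu hxu

theorem ediam_codingMap_image_le (h : S.IsRatio c a b) (hc : S.Scales c) (hΔ : S.IsSeed Δ) {τ : S.Labelling}
    {v : List (Fin S.maxN)} (hv : S.IsCoding τ v) {q r : ℝ} (hq : S.cratio c τ v ≤ q)
    (hr : q * Metric.diam Δ ≤ r) :
    Metric.ediam (S.codingMap τ v '' Δ) ≤ ENNReal.ofReal r := by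
  refine Metric.ediam_le ?_
  rintro _ ⟨x, hx, rfl⟩ _ ⟨y, hy, rfl⟩
  rw [edist_dist, hc.dist_codingMap hv]
  refine ENNReal.ofReal_le_ofReal (le_trans ?_ hr)
  exact mul_le_mul hq (Metric.dist_le_diam_of_mem hΔ.1.isBounded hx hy) dist_nonneg
    ((cratio_pos h τ v).le.trans hq)

/-- Two-stage covering: at most `K` pieces of size `R` meet the ball, and each is cut by the line at
the relative scale `ξ` of its own subtree into at most `Z` pieces of diameter at most `r`. -/
theorem coverNum_ball_inter_randomSet_le (h : S.IsRatio c a b) (hc : S.Scales c)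
    (hΔ : S.IsSeed Δ) {K : ℕ} {τ : S.Labelling} {x : EuclideanSpace ℝ (Fin d)} {R ξ r : ℝ}
    (hR : 0 < R) (hR1 : R ≤ 1) (hξ : 0 < ξ) (hξ1 : ξ ≤ 1) (hr : R * ξ * Metric.diam Δ ≤ r)
    (hK : {v | S.InCut c R τ v ∧
      (S.codingMap τ v '' Δ ∩ Metric.ball x (2 * R)).Nonempty}.ncard ≤ K) {Z : ℕ}
    (hZ : ∀ v, S.InCut c R τ v → S.cutCount c univ ξ (S.sub τ v) ≤ Z) :
    coverNum r (Metric.ball x R ∩ S.randomSet Δ τ) ≤ (K * Z : ℕ) := by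
  classical
  set V := {v | S.InCut c R τ v ∧ (S.codingMap τ v '' Δ ∩ Metric.ball x (2 * R)).Nonempty}
  have hV : V.Finite := (cutSet_finite h univ hR τ).subset fun v hv => ⟨hv.1, mem_univ _⟩
  have hW : ∀ v, (S.cutSet c univ ξ (S.sub τ v)).Finite := fun v => cutSet_finite h univ hξ _
  set L := hV.toFinset.biUnion fun v => (hW v).toFinset.image fun w => v ++ w
  have hcard : L.card ≤ K * Z := by
    refine (Finset.card_biUnion_le_card_mul _ _ Z fun v hv => ?_).trans ?_
    · refine Finset.card_image_le.trans ?_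
      rw [← Set.ncard_eq_toFinset_card _ (hW v)]
      exact hZ v ((Set.Finite.mem_toFinset _).1 hv).1
    · rw [← Set.ncard_eq_toFinset_card _ hV]
      exact Nat.mul_le_mul_right _ hK
  refine (coverNum_le_card L (fun u => S.codingMap τ u '' Δ) ?_ ?_).trans (Nat.cast_le.2 hcard)
  · intro u hu
    obtain ⟨v, hv, hu⟩ := Finset.mem_biUnion.1 hu
    obtain ⟨w, hw, rfl⟩ := Finset.mem_image.1 hu
    have hv' := ((Set.Finite.mem_toFinset _).1 hv).1
    have hw' := ((Set.Finite.mem_toFinset _).1 hw).1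
    refine ediam_codingMap_image_le h hc hΔ ((isCoding_append _ _ _).2 ⟨hv'.isCoding, hw'.isCoding⟩)
      ?_ hr
    rw [cratio_append]
    exact mul_le_mul (hv'.cratio_bounds h hR hR1).2 (hw'.cratio_bounds h hξ hξ1).2
      (cratio_pos h _ _).le hR.le
  · rintro z ⟨hzx, hz⟩
    obtain ⟨v, w, hv, hw, hzv⟩ := exists_prefix_mem h hΔ hz hR hξ
    refine mem_iUnion₂.2 ⟨v ++ w, Finset.mem_biUnion.2 ⟨v, (Set.Finite.mem_toFinset _).2
      ⟨hv, z, ?_, ?_⟩, Finset.mem_image.2 ⟨w, (Set.Finite.mem_toFinset _).2 ⟨hw, mem_univ _⟩, rfl⟩⟩,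
      hzv⟩
    · exact codingMap_append_image_subset hΔ.2.2
        ((isCoding_append _ _ _).2 ⟨hv.isCoding, hw.isCoding⟩) hzv
    · exact Metric.ball_subset_ball (by linarith) hzx

theorem coverNum_randomSet_le (h : S.IsRatio c a b) (hc : S.Scales c) (hΔ : S.IsSeed Δ)
    {τ : S.Labelling} {ξ r : ℝ} (hξ : 0 < ξ) (hξ1 : ξ ≤ 1) (hr : ξ * Metric.diam Δ ≤ r) :
    coverNum r (S.randomSet Δ τ) ≤ S.cutCount c univ ξ τ := by
  have hW := cutSet_finite h univ hξ τ
  rw [cutCount, Set.ncard_eq_toFinset_card _ hW]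
  refine coverNum_le_card hW.toFinset (fun u => S.codingMap τ u '' Δ) ?_ ?_
  · intro v hv
    have hv' := ((Set.Finite.mem_toFinset _).1 hv).1
    exact ediam_codingMap_image_le h hc hΔ hv'.isCoding (hv'.cratio_bounds h hξ hξ1).2 hr
  · intro z hz
    obtain ⟨v, w, hv, hw, hzv⟩ := exists_prefix_mem h hΔ hz hξ one_pos
    refine mem_iUnion₂.2 ⟨v, (Set.Finite.mem_toFinset _).2 ⟨hv, mem_univ _⟩, ?_⟩
    exact codingMap_append_image_subset hΔ.2.2
      ((isCoding_append _ _ _).2 ⟨hv.isCoding, hw.isCoding⟩) hzv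

/-- The piece of a surviving node contains a point of the random set. Assigning to the node a
covering set that contains this point is at most `K`-to-one, since a set of diameter at most `ξ`
lies in a ball of radius `2 * ξ`. -/
theorem cutCount_alive_le (h : S.IsRatio c a b) (hc : S.Scales c) (hΔ : S.IsSeed Δ) {K : ℕ}
    {τ : S.Labelling} {ξ : ℝ} (hξ : 0 < ξ)
    (hK : ∀ x, {v | S.InCut c ξ τ v ∧
      (S.codingMap τ v '' Δ ∩ Metric.ball x (2 * ξ)).Nonempty}.ncard ≤ K) :
    S.cutCount c S.alive ξ τ ≤ K * (coverNum ξ (S.randomSet Δ τ)).toNat := by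
  classical
  have hW := cutSet_finite h S.alive hξ τ
  obtain ⟨U, hU1, hU2, hU3⟩ := exists_cover_of_coverNum_ne_top
    (coverNum_ne_top hξ (totallyBounded_randomSet hΔ τ))
  have hx : ∀ v ∈ S.cutSet c S.alive ξ τ, ∃ x ∈ S.codingMap τ v '' Δ, ∃ u ∈ U, x ∈ u := by
    intro v hv
    obtain ⟨z, hz⟩ := randomSet_nonempty hc hΔ hv.2
    refine ⟨_, mem_image_of_mem _ (randomSet_subset_seed hΔ _ hz), ?_⟩
    simpa using hU2 (codingMap_mem_randomSet hΔ hv.1.isCoding hz)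
  choose! x hxv u huU hxu using hx
  rw [cutCount, Set.ncard_eq_toFinset_card _ hW, ← hU3, ENat.toNat_natCast]
  refine Finset.card_le_mul_card_image_of_maps_to (f := u)
    (fun v hv => huU v ((Set.Finite.mem_toFinset _).1 hv)) K fun w hw => ?_
  rcases (hW.toFinset.filter fun v => u v = w).eq_empty_or_nonempty with h0 | ⟨v₀, hv₀⟩
  · rw [h0]; simp
  · rw [Finset.mem_filter, Set.Finite.mem_toFinset] at hv₀
    refine le_trans ?_ (hK (x v₀))
    rw [← Set.ncard_coe_finset]
    refine Set.ncard_le_ncard ?_ ((cutSet_finite h univ hξ τ).subset fun v hv => ⟨hv.1, mem_univ _⟩)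
    intro v hv
    rw [Finset.mem_coe, Finset.mem_filter, Set.Finite.mem_toFinset] at hv
    refine ⟨hv.1.1, x v, hxv v hv.1, ?_⟩
    have h1 := hxu v hv.1
    have h2 := hxu v₀ hv₀.1
    rw [hv.2] at h1
    rw [hv₀.2] at h2
    have h3 := (Metric.edist_le_ediam_of_mem h1 h2).trans (hU1 w hw)
    rw [edist_dist, ENNReal.ofReal_le_ofReal_iff hξ.le] at h3
    rw [Metric.mem_ball]
    linarith

end RIFS

/-! ### From node counts to dimensions -/

namespace RIFS

variable {d k : ℕ} {S : RIFS d k} {c : S.Λ → Fin S.maxN → ℝ} {a b : ℝ}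

/-- In dimension `0` all images of `O` coincide, so disjointness allows at most one map per system.
Positive dimension is needed to read ratios off from distances. -/
theorem UOSC.dim_pos (hO : S.UOSC) (hne : S.NonExtinguishing) : 0 < d := by
  by_contra hd
  obtain rfl : d = 0 := by omega
  obtain ⟨O, -, ⟨y, hy⟩, -, hdisj⟩ := hO
  have hN : ∀ l, S.N l ≤ 1 := fun l => by
    by_contra! hcon
    have hM := S.N_le l
    have := hdisj l ⟨0, by omega⟩ ⟨1, by omega⟩ (by simp; omega) (by simpa using hcon)
      ⟨_, mem_image_of_mem _ hy, y, hy, Subsingleton.elim _ _⟩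
    simp at this
  have h1 : ∫ l, (S.N l : ℝ) ∂S.μ ≤ ∫ _l, (1 : ℝ) ∂S.μ :=
    integral_mono (S.integrable_comp_N fun n => (n : ℝ)) (integrable_const _) fun l => by
      exact Nat.cast_le_one.2 (hN l)
  simp only [integral_const, probReal_univ, one_smul] at h1
  exact absurd hne (not_lt.2 h1)

theorem UniformSimilarities.exists_ratio (hsim : S.UniformSimilarities) (hd : 0 < d) :
    ∃ c a b, S.IsRatio c a b ∧ S.Scales c := by
  classical
  obtain ⟨a, b, ha, hab, hb, hf⟩ := hsim
  set e : EuclideanSpace ℝ (Fin d) := EuclideanSpace.single ⟨0, hd⟩ 1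
  have he : dist (0 : EuclideanSpace ℝ (Fin d)) e = 1 := by simp [e]
  -- The ratio is the distance between the images of two points at distance `1`, which makes it
  -- measurable. The value `b` at indices without a map keeps the bounds valid everywhere.
  set c : S.Λ → Fin S.maxN → ℝ := fun l i =>
    if (i : ℕ) < S.N l then dist (S.f l i 0) (S.f l i e) else b
  have hc : ∀ l (i : Fin S.maxN), (i : ℕ) < S.N l → a ≤ c l i ∧ c l i ≤ b ∧
      ∀ x y, dist (S.f l i x) (S.f l i y) = c l i * dist x y := fun l i hi => by
    obtain ⟨r, hr1, hr2, hr⟩ := hf l i hi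
    have : c l i = r := by simp only [c]; rw [if_pos hi, hr, he, mul_one]
    rw [this]
    exact ⟨hr1, hr2, hr⟩
  refine ⟨c, a, b, ⟨ha, hab, hb, fun l i => ?_, fun l i => ?_, fun i => ?_⟩,
    fun l i hi => (hc l i hi).2.2⟩
  · by_cases hi : (i : ℕ) < S.N l
    · exact (hc l i hi).1
    · simpa [c, hi] using hab
  · by_cases hi : (i : ℕ) < S.N l
    · exact (hc l i hi).2.1
    · simp [c, hi]
  · refine measurable_of_restrict_of_restrict_compl (S.measurableSet_lt_N i) ?_ ?_
    · have : ({l : S.Λ | (i : ℕ) < S.N l}.domRestrict fun l => c l i) =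
          fun l : {l : S.Λ // (i : ℕ) < S.N l} => dist (S.f l.1 i 0) (S.f l.1 i e) := by
        funext l
        exact if_pos l.2
      rw [this]
      exact (S.measurable_f i 0).dist (S.measurable_f i e)
    · have : ({l : S.Λ | (i : ℕ) < S.N l}ᶜ.domRestrict fun l => c l i) = fun _ => b := by
        funext l
        exact if_neg l.2
      rw [this]
      exact measurable_const

variable {Δ : Set (EuclideanSpace ℝ (Fin d))} {τ : S.Labelling}

theorem eventually_coverNum_randomSet_le (h : S.IsRatio c a b) (hc : S.Scales c)
    (hΔ : S.IsSeed Δ) {t : ℝ} (ht : 0 ≤ t)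
    (hU : ∀ᶠ n : ℕ in atTop, (S.cutCount c univ (b ^ n) τ : ℝ) ≤ (b ^ n) ^ (-t)) :
    ∃ C > 0, ∀ᶠ r in 𝓝[>] (0 : ℝ),
      ((coverNum r (S.randomSet Δ τ)).toNat : ℝ) ≤ C * r ^ (-t) := by
  have hb := h.b_pos
  set D := Metric.diam Δ + 1
  have hD : 1 ≤ D := by simp [D, Metric.diam_nonneg]
  have hD0 : 0 < D := one_pos.trans_le hD
  obtain ⟨n₀, hn₀⟩ := eventually_atTop.1 hU
  refine ⟨(b / D) ^ (-t), by positivity, ?_⟩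
  have hlt : ∀ᶠ r in 𝓝[>] (0 : ℝ), r < D * b ^ n₀ :=
    (eventually_lt_nhds (by positivity)).filter_mono nhdsWithin_le_nhds
  filter_upwards [hlt, self_mem_nhdsWithin] with r hr hr0
  have hr0 : 0 < r := hr0
  have hx : 0 < r / D := div_pos hr0 hD0
  have hxn : r / D < b ^ n₀ := (div_lt_iff₀' hD0).2 hr
  obtain ⟨n, hn1, hn2⟩ := exists_nat_pow_near_of_lt_one hx
    (hxn.le.trans (pow_le_one₀ hb.le h.lt_one.le)) hb h.lt_one
  have hn : n₀ ≤ n + 1 := by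
    by_contra! hcon
    exact absurd (hn1.trans hxn) (not_lt.2 (pow_le_pow_of_le_one hb.le h.lt_one.le hcon.le))
  have hle : b ^ (n + 1) * Metric.diam Δ ≤ r := by
    have h1 : b ^ (n + 1) * D ≤ r := ((lt_div_iff₀ hD0).1 hn1).le
    have h2 : Metric.diam Δ ≤ D := by simp [D]
    exact (mul_le_mul_of_nonneg_left h2 (by positivity)).trans h1
  have h1 := coverNum_randomSet_le h hc hΔ (τ := τ) (pow_pos hb (n + 1))
    (pow_le_one₀ hb.le h.lt_one.le) hle
  have h2 : ((coverNum r (S.randomSet Δ τ)).toNat : ℝ) ≤ S.cutCount c univ (b ^ (n + 1)) τ :=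
    Nat.cast_le.2 (ENat.toNat_le_of_le_natCast h1)
  refine h2.trans ((hn₀ _ hn).trans ?_)
  rw [← Real.mul_rpow (by positivity) hr0.le]
  refine Real.rpow_le_rpow_of_nonpos (by positivity) ?_ (by linarith)
  calc b / D * r = r / D * b := by ring
    _ ≤ b ^ n * b := mul_le_mul_of_nonneg_right hn2 hb.le
    _ = b ^ (n + 1) := (pow_succ b n).symm

theorem exists_localCoverNum_randomSet_le (h : S.IsRatio c a b) (hc : S.Scales c)
    (hO : S.UOSC) (hΔ : S.IsSeed Δ) {t : ℝ} (ht : 0 ≤ t)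
    (hU : ∀ K : ℕ, ∀ᶠ n : ℕ in atTop, ∀ v : List (Fin S.maxN), v.length ≤ K * n →
      (S.cutCount c univ (b ^ n) (S.sub τ v) : ℝ) ≤ (b ^ n) ^ (-t)) {θ : ℝ}
    (hθ : θ ∈ Ioo (0 : ℝ) 1) :
    ∃ C r₀ : ℝ, 0 < C ∧ 0 < r₀ ∧ ∀ r : ℝ, 0 < r → r < r₀ →
      (localCoverNum r (r ^ θ) (S.randomSet Δ τ) : ℝ≥0∞) ≤
        ENNReal.ofReal (C * (r ^ θ / r) ^ t) := by
  have hb := h.b_pos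
  obtain ⟨M, hM⟩ := exists_overlap_bound h hc hO hΔ.1
  set D := Metric.diam Δ + 1
  have hD : 1 ≤ D := by simp [D, Metric.diam_nonneg]
  have hD0 : 0 < D := one_pos.trans_le hD
  have hθ1 : 0 < 1 - θ := by linarith [hθ.2]
  obtain ⟨K, hK⟩ := exists_nat_ge (θ / (1 - θ))
  obtain ⟨n₀, hn₀⟩ := eventually_atTop.1 (hU K)
  have hpow : Tendsto (fun r : ℝ => r ^ (1 - θ)) (𝓝[>] 0) (𝓝 0) := by
    have := (Real.continuousAt_rpow_const 0 (1 - θ) (Or.inr hθ1.le)).tendsto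
    rw [Real.zero_rpow hθ1.ne'] at this
    exact this.mono_left nhdsWithin_le_nhds
  obtain ⟨r₁, hr₁, hsub⟩ := mem_nhdsGT_iff_exists_Ioo_subset.1
    (hpow.eventually_lt_const (by positivity : 0 < b ^ n₀))
  refine ⟨(M + 1) * (b / D) ^ (-t), min r₁ 1, by positivity, lt_min hr₁ one_pos,
    fun r hr hrlt => ?_⟩
  have hr1 : r < 1 := hrlt.trans_le (min_le_right _ _)
  have hy : r ^ (1 - θ) < b ^ n₀ := hsub ⟨hr, hrlt.trans_le (min_le_left _ _)⟩
  set y := r ^ (1 - θ)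
  have hy0 : 0 < y := Real.rpow_pos_of_pos hr _
  have hx : 0 < y / D := div_pos hy0 hD0
  have hxy : y / D ≤ y := div_le_self hy0.le hD
  -- The relative scale `r / R = y` is replaced by a power of `b` within a factor `b / D` of it; `D`
  -- exceeds the diameter of `Δ`, so the pieces have diameter at most `r`.
  obtain ⟨n, hn1, hn2⟩ := exists_nat_pow_near_of_lt_one hx
    ((hxy.trans hy.le).trans (pow_le_one₀ hb.le h.lt_one.le)) hb h.lt_one
  have hn : n₀ ≤ n + 1 := by
    by_contra! hcon
    exact absurd (hn1.trans (hxy.trans_lt hy))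
      (not_lt.2 (pow_le_pow_of_le_one hb.le h.lt_one.le hcon.le))
  set ξ := b ^ (n + 1)
  have hξ : 0 < ξ := pow_pos hb _
  have hξ1 : ξ ≤ 1 := pow_le_one₀ hb.le h.lt_one.le
  set R := r ^ θ
  have hR : 0 < R := Real.rpow_pos_of_pos hr θ
  have hR1 : R ≤ 1 := Real.rpow_le_one hr.le hr1.le hθ.1.le
  have hRy : R * y = r := by
    simp only [R, y]; rw [← Real.rpow_add hr]; simp
  have hle : R * ξ * Metric.diam Δ ≤ r := by
    have h1 : ξ * D ≤ y := ((lt_div_iff₀ hD0).1 hn1).le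
    have h2 : Metric.diam Δ ≤ D := by simp [D]
    rw [mul_assoc, ← hRy]
    exact mul_le_mul_of_nonneg_left ((mul_le_mul_of_nonneg_left h2 hξ.le).trans h1) hR.le
  -- Since `K * (1 - θ) ≥ θ`, the nodes of the line at `R` have level at most `K * (n + 1)`, inside
  -- the range where the subtree bound holds.
  have hlen : b ^ (K * (n + 1)) ≤ R := by
    have h1 : b ^ (K * (n + 1)) ≤ y ^ K := by
      rw [mul_comm, pow_mul]
      exact pow_le_pow_left₀ hξ.le (hn1.le.trans hxy) K
    refine h1.trans ?_
    simp only [y, R]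
    rw [← Real.rpow_natCast, ← Real.rpow_mul hr.le]
    refine Real.rpow_le_rpow_of_exponent_ge hr hr1.le ?_
    have := (div_le_iff₀ hθ1).1 hK
    linarith
  have hZ : ∀ v, S.InCut c R τ v → S.cutCount c univ ξ (S.sub τ v) ≤ ⌊ξ ^ (-t)⌋₊ := fun v hv =>
    Nat.le_floor (hn₀ _ hn v (hv.length_le h hlen))
  have hloc : localCoverNum r R (S.randomSet Δ τ) ≤ (M * ⌊ξ ^ (-t)⌋₊ : ℕ) :=
    iSup₂_le fun x _ => coverNum_ball_inter_randomSet_le h hc hΔ hR hR1 hξ hξ1 hle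
      (hM τ R hR hR1 x) hZ
  refine (ENat.toENNReal_le.2 hloc).trans ?_
  rw [ENat.toENNReal_coe, ← ENNReal.ofReal_natCast]
  refine ENNReal.ofReal_le_ofReal ?_
  push_cast
  have hfl : (⌊ξ ^ (-t)⌋₊ : ℝ) ≤ ξ ^ (-t) := Nat.floor_le (by positivity)
  have hRr : R / r = y⁻¹ := by
    rw [← hRy]; field_simp
  have hξt : ξ ^ (-t) ≤ (b / D) ^ (-t) * (R / r) ^ t := by
    rw [hRr, Real.inv_rpow hy0.le, ← Real.rpow_neg hy0.le, ← Real.mul_rpow (by positivity) hy0.le]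
    refine Real.rpow_le_rpow_of_nonpos (by positivity) ?_ (by linarith)
    calc b / D * y = y / D * b := by ring
      _ ≤ b ^ n * b := mul_le_mul_of_nonneg_right hn2 hb.le
      _ = ξ := (pow_succ b n).symm
  rw [mul_assoc]
  exact mul_le_mul (by linarith) (hfl.trans hξt) (Nat.cast_nonneg _) (by positivity)

theorem eventually_le_coverNum_randomSet (h : S.IsRatio c a b) (hc : S.Scales c)
    (hO : S.UOSC) (hΔ : S.IsSeed Δ) {t : ℝ}
    (hL : ∃ C > 0, ∃ ξ₀ > 0, ∀ ξ : ℝ, 0 < ξ → ξ < ξ₀ →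
      C * ξ ^ (-t) ≤ S.cutCount c S.alive ξ τ) :
    ∃ C > 0, ∀ᶠ r in 𝓝[>] (0 : ℝ),
      C * r ^ (-t) ≤ ((coverNum r (S.randomSet Δ τ)).toNat : ℝ) := by
  obtain ⟨M, hM⟩ := exists_overlap_bound h hc hO hΔ.1
  obtain ⟨C, hC, ξ₀, hξ₀, hL⟩ := hL
  refine ⟨C / (M + 1), by positivity, ?_⟩
  filter_upwards [Ioo_mem_nhdsGT (lt_min hξ₀ one_pos)] with r hr
  have h1 := hL r hr.1 (hr.2.trans_le (min_le_left _ _))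
  have h2 := cutCount_alive_le h hc hΔ hr.1
    (hM τ r hr.1 (hr.2.le.trans (min_le_right _ _)))
  have h3 : (S.cutCount c S.alive r τ : ℝ) ≤ M * (coverNum r (S.randomSet Δ τ)).toNat := by
    exact_mod_cast h2
  rw [div_mul_eq_mul_div, div_le_iff₀ (by positivity)]
  have h4 : (0 : ℝ) ≤ (coverNum r (S.randomSet Δ τ)).toNat := Nat.cast_nonneg _
  linarith

end RIFS

theorem mainTheorem2 (d k : ℕ) (S : RIFS d k)
    (hsim : S.UniformSimilarities) (hne : S.NonExtinguishing) (hO : S.UOSC)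
    (Δ : Set (EuclideanSpace ℝ (Fin d))) (hΔ : S.IsSeed Δ) :
    ∀ᵐ τ ∂S.prob, ∃ s : ℝ≥0, HasBoxDim (S.randomSet Δ τ) s ∧
      ∀ θ ∈ Set.Ioo (0 : ℝ) 1, assouadSpectrum θ (S.randomSet Δ τ) = s := by
  obtain ⟨c, a, b, h, hc⟩ := hsim.exists_ratio (hO.dim_pos hne)
  obtain ⟨s, hs, hlow, hup⟩ := RIFS.exists_critical h hne
  filter_upwards [RIFS.ae_eventually_cutCount_le h hs hup,
    RIFS.ae_le_cutCount_alive h hne hlow] with τ hU hL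
  by_cases hτ : τ ∈ S.alive
  swap
  · rw [RIFS.randomSet_eq_empty hτ]
    exact ⟨0, hasBoxDim_empty, fun θ _ => by simp [assouadSpectrum_empty]⟩
  have htb := RIFS.totallyBounded_randomSet hΔ τ
  have hbox : HasBoxDim (S.randomSet Δ τ) ⟨s, hs⟩ := by
    refine hasBoxDim_of_bounds ?_ (fun t ht => ?_) fun t ht0 ht => ?_
    · filter_upwards [self_mem_nhdsWithin] with r hr
      refine Nat.one_le_iff_ne_zero.2 fun h0 => ?_
      rcases ENat.toNat_eq_zero.1 h0 with h1 | h1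
      · exact coverNum_ne_zero (RIFS.randomSet_nonempty hc hΔ hτ) h1
      · exact coverNum_ne_top hr htb h1
    · refine RIFS.eventually_coverNum_randomSet_le h hc hΔ (hs.trans (le_of_lt ht)) ?_
      -- For `K = 0` the uniform bound concerns the root alone, which is enough for the box
      -- dimension.
      filter_upwards [hU t ht 0] with n hn
      simpa using hn [] (by simp)
    · exact RIFS.eventually_le_coverNum_randomSet h hc hO hΔ (hL hτ t ht0 ht)
  refine ⟨⟨s, hs⟩, hbox, fun θ hθ => le_antisymm ?_ (le_assouadSpectrum htb hbox hθ)⟩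
  exact assouadSpectrum_le htb hθ fun α hα =>
    RIFS.exists_localCoverNum_randomSet_le h hc hO hΔ α.2 (hU α hα) hθ
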